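/- Setting. All state spaces, control spaces and controller memories are Polish spaces with their Borel $\sigma$-algebras; $\mathbb Y$ is a metric space with its Borel $\sigma$-algebra. A gMDP over $\mathbb Y$ is a tuple $\mathbf M=(\mathbb X,\pi,\mathbb T,\mathbb A,h,\mathbb Y)$ with state space $\mathbb X$, control space $\mathbb A$, initial probability measure $\pi$, Borel stochastic kernel $\mathbb T(\cdot\mid x,u)$ on $\mathbb X$ given $\mathbb X\times\mathbb A$, and measurable output map $h:\mathbb X\to\mathbb Y$. For a probability measure $p$ on $\mathbb A$ put $\mathbb T(\cdot\mid x,p)=\int\mathbb T(\cdot\mid x,u)\,p(du)$. A time-homogeneous Markov policy is given by a universally measurable map $\mu:\mathbb X\to\mathcal P(\mathbb A)$. A control strategy $\mathbf C$ consists of a memory space $\mathbb X_{\mathbf C}$, an initial memory $x_{\mathbf C0}$, a universally measurable stochastic kernel $\mathbb T_{\mathbf C}(\cdot\mid x_{\mathbf C},x)$ on $\mathbb X_{\mathbf C}$ and a universally measurable map $h_{\mathbf C}:\mathbb X_{\mathbf C}\to\mathcal P(\mathbb A)$. In the controlled system $\mathbf C\times\mathbf M$ one has $x(0)\sim\pi$,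 $x_{\mathbf C}(0)=x_{\mathbf C0}$ and, for all $t\ge 0$, $x_{\mathbf C}(t+1)\sim\mathbb T_{\mathbf C}(\cdot\mid x_{\mathbf C}(t),x(t))$, then $u(t)\sim h_{\mathbf C}(x_{\mathbf C}(t+1))$, then $x(t+1)\sim\mathbb T(\cdot\mid x(t),u(t))$; its law on infinite paths is $\mathbb P_{\mathbf C\times\mathbf M}$. For measurable $K\subset\mathbb Y$, $\lozenge K$ is the event that $h(x(t))\in K$ for some $t\ge 0$. For $\delta\in\mathbb R$ and $\epsilon\ge 0$, $\mathbf M_1\preceq^\delta_\epsilon\mathbf M_2$ means: there are a measurable relation $\mathcal R\subset\mathbb X_1\times\mathbb X_2$, a Borel measurable map $\mathcal U:\mathbb A_1\times\mathbb X_1\times\mathbb X_2\to\mathcal P(\mathbb A_2)$ and a Borel stochastic kernel $\mathbb W(\cdot\mid u_1,x_1,x_2)$ on $\mathbb X_1\times\mathbb X_2$ such that for all $(x_1,x_2)\in\mathcal R$: $\mathbf d_{\mathbb Y}(h_1(x_1),h_2(x_2))\le\epsilon$, and for every $u_1\in\mathbb A_1$ the measure $\mathbb W(\cdot\mid u_1,x_1,x_2)$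 has marginals $\mathbb T_1(\cdot\mid x_1,u_1)$ and $\mathbb T_2(\cdot\mid x_2,\mathcal U(u_1,x_1,x_2))$ and gives $\mathcal R$ probability at least $1-\delta$; and some probability measure on $\mathbb X_1\times\mathbb X_2$ has marginals $\pi_1,\pi_2$ and gives $\mathcal R$ probability at least $1-\delta$. A policy $\mu$ for $\mathbf M_1$ reaches $K$ $(\epsilon,\delta)$-robustly with probability $p$ if for every gMDP $\mathbf M_2$ over $\mathbb Y$ with $\mathbf M_1\preceq^\delta_\epsilon\mathbf M_2$ there is a control strategy $\mathbf C_2$ for $\mathbf M_2$ with $\mathbb P_{\mathbf C_2\times\mathbf M_2}(\lozenge K)\ge p$. Let $\mathbf M_1=(\mathbb X_1,\pi_1,\mathbb T_1,\mathbb A_1,h_1,\mathbb Y)$ be a gMDP, $K\subset\mathbb Y$ measurable, $K_{\mathbb X_1}=h_1^{-1}(K)$, $\delta\in\mathbb R$, $\mathbf L(r)=\min(1,\max(0,r))$. For universally measurable $\nu:\mathbb X_1\to\mathcal P(\mathbb A_1)$ put $$\mathbf T^\nu_\delta(V)(x)=\mathbf L\Big(\int_{\mathbb X_1}\big[\mathbf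 1_{K_{\mathbb X_1}}(\bar x)+\mathbf 1_{\mathbb X_1\setminus K_{\mathbb X_1}}(\bar x)V(\bar x)\big]\,\mathbb T_1(d\bar x\mid x,\nu(x))-\delta\Big),\qquad \mathbf T^*_\delta(V)(x)=\sup_\nu\mathbf T^\nu_\delta(V)(x)$$ (with the supremum read as $0$ in the degenerate case $\mathbb A_1=\emptyset$). Statement. (1) Let $\mu$ be a time-homogeneous Markov policy for $\mathbf M_1$. The sequence $(\mathbf T^\mu_\delta)^q(0)$, $q\ge 0$, is pointwise monotonically increasing and converges pointwise to a function $V^\delta:\mathbb X_1\to[0,1]$ with $V^\delta=\mathbf T^\mu_\delta(V^\delta)$, and $K$ is reached $(0,\delta)$-robustly with policy $\mu$ and with probability $$r^\mu(K_{\mathbb X_1}):=\mathbf L\Big(\int_{\mathbb X_1}\big[\mathbf 1_{K_{\mathbb X_1}}(x)+\mathbf 1_{\mathbb X_1\setminus K_{\mathbb X_1}}(x)V^\delta(x)\big]\,\pi_1(dx)-\delta\Big).$$ (2) The sequence $(\mathbf T^*_\delta)^q(0)$, $q\ge 0$, is pointwise monotonically increasing and converges pointwise to a function $V^{\delta,*}:\mathbb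 X_1\to[0,1]$ with $V^{\delta,*}=\mathbf T^*_\delta(V^{\delta,*})$. (3) Call a time-homogeneous Markov policy $\mu^*$ for $\mathbf M_1$ optimal $(0,\delta)$-robust if $\mu^*\in\arg\sup_\mu\mathbf T^\mu_\delta(V^{\delta,*})$, that is, $\mathbf T^{\mu}_\delta(V^{\delta,*})(x)\le\mathbf T^{\mu^*}_\delta(V^{\delta,*})(x)$ for all $x\in\mathbb X_1$ and all universally measurable $\mu:\mathbb X_1\to\mathcal P(\mathbb A_1)$. Every such $\mu^*$ satisfies $\mathbf T^{\mu^*}_\delta(V^{\delta,*})=V^{\delta,*}$, and $K$ is reached $(0,\delta)$-robustly with policy $\mu^*$ and with probability $r^{\mu^*}(K_{\mathbb X_1})$. -/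

import Mathlib

open MeasureTheory ProbabilityTheory Filter Topology

universe u v

/-- A map is universally measurable if the preimage of every measurable set lies in the completion
of the domain with respect to every finite measure. -/
def UniversallyMeasurable {α β : Type*} [MeasurableSpace α] [MeasurableSpace β]
    (f : α → β) : Prop :=
  ∀ m : Measure α, IsFiniteMeasure m → NullMeasurable f m

/-- Universally measurable stochastic kernels, that is, universally measurable maps from `α` to the
probability measures on `β`. -/
structure UMKernel (α β : Type*) [MeasurableSpace α] [MeasurableSpace β] where
  /-- the probability measure attached to a point -/
  toFun : α → Measure β
  isProb : ∀ a, IsProbabilityMeasure (toFun a)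
  umeas : UniversallyMeasurable toFun

/-- A general Markov decision process with output space `Y`: Polish state space `X`, Polish control
space `A`, initial distribution, Borel transition kernel and measurable output map. -/
structure GMDP (Y : Type v) [MeasurableSpace Y] where
  /-- the state space -/
  X : Type u
  [topX : TopologicalSpace X]
  [polishX : PolishSpace X]
  [measX : MeasurableSpace X]
  [borelX : BorelSpace X]
  /-- the control space -/
  A : Type u
  [topA : TopologicalSpace A]
  [polishA : PolishSpace A]
  [measA : MeasurableSpace A]
  [borelA : BorelSpace A]
  /-- the initial probability measure -/
  init : Measure X
  [probInit : IsProbabilityMeasure init]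
  /-- the transition kernel -/
  T : Kernel (X × A) X
  [markovT : IsMarkovKernel T]
  /-- the output map -/
  h : X → Y
  measurable_h : Measurable h

attribute [instance] GMDP.topX GMDP.polishX GMDP.measX GMDP.borelX GMDP.topA GMDP.polishA
  GMDP.measA GMDP.borelA GMDP.probInit GMDP.markovT

/-- A Markov policy: a sequence of universally measurable maps from the states to the probability
measures on the controls. -/
def MarkovPolicy {Y : Type v} [MeasurableSpace Y] (M : GMDP.{u, v} Y) : Type u :=
  ℕ → UMKernel M.X M.A

/-- The time-homogeneous Markov policy that applies `ν` at every time. -/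
def homogeneous {Y : Type v} [MeasurableSpace Y] {M : GMDP.{u, v} Y} (ν : UMKernel M.X M.A) :
    MarkovPolicy M :=
  fun _ => ν

/-- The transition probability `T(· | x, p) = ∫ T(· | x, u) p(du)` under a randomised control `p`. -/
noncomputable def GMDP.trans {Y : Type v} [MeasurableSpace Y] (M : GMDP.{u, v} Y)
    (x : M.X) (p : Measure M.A) : Measure M.X :=
  p.bind (fun a => M.T (x, a))

/-- A control strategy for `M`: a Polish memory space with an initial memory state, a universally
measurable memory update reading the current memory and the current state of `M`, and a universally
measurable output map to the probability measures on the controls. -/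
structure ControlStrategy {Y : Type v} [MeasurableSpace Y] (M : GMDP.{u, v} Y) where
  /-- the memory space -/
  X : Type u
  [topX : TopologicalSpace X]
  [polishX : PolishSpace X]
  [measX : MeasurableSpace X]
  [borelX : BorelSpace X]
  /-- the initial memory state -/
  x0 : X
  /-- the memory update -/
  T : UMKernel (X × M.X) X
  /-- the output map -/
  h : UMKernel X M.A

attribute [instance] ControlStrategy.topX ControlStrategy.polishX ControlStrategy.measX
  ControlStrategy.borelX

/-- Probability that, from the state `s.1` and the memory `s.2`, the next state lies in `D` and the
next memory in `E`: first the memory `c` is drawn from the memory update, then a control from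
the output map at `c`, then the next state. -/
noncomputable def stepProb {Y : Type v} [MeasurableSpace Y] {M : GMDP.{u, v} Y}
    (C : ControlStrategy M) (s : M.X × C.X) (D : Set M.X) (E : Set C.X) : ENNReal :=
  ∫⁻ c in E, M.trans s.1 (C.h.toFun c) D ∂(C.T.toFun (s.2, s.1))

/-- `P` is the law of the execution (states and memories) of `M` controlled by `C`, on the space of
infinite paths. -/
structure IsExecutionLaw {Y : Type v} [MeasurableSpace Y] {M : GMDP.{u, v} Y}
    (C : ControlStrategy M) (P : Measure (ℕ → M.X × C.X)) : Prop where
  isProb : IsProbabilityMeasure P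
  initial : P.map (fun ω => ω 0) = M.init.prod (Measure.dirac C.x0)
  step : ∀ (n : ℕ) (B : Set (Finset.Iic n → M.X × C.X)) (D : Set M.X) (E : Set C.X),
    MeasurableSet B → MeasurableSet D → MeasurableSet E →
      P {ω | (fun i : Finset.Iic n => ω i) ∈ B ∧ (ω (n + 1)).1 ∈ D ∧ (ω (n + 1)).2 ∈ E}
        = ∫⁻ ω in {ω | (fun i : Finset.Iic n => ω i) ∈ B}, stepProb C (ω n) D E ∂P

/-- The event that the output trace eventually reaches `K`. -/
def eventuallyReaches {Y : Type v} [MeasurableSpace Y] {M : GMDP.{u, v} Y}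
    (C : ControlStrategy M) (K : Set Y) : Set (ℕ → M.X × C.X) :=
  {ω | ∃ t, M.h (ω t).1 ∈ K}

/-- `W` is a lifting of `(Δ, Θ)` for the relation `R` with deficit `δ`. -/
structure IsLifting {X₁ X₂ : Type*} [MeasurableSpace X₁] [MeasurableSpace X₂]
    (R : Set (X₁ × X₂)) (δ : ℝ) (Δ : Measure X₁) (Θ : Measure X₂) (W : Measure (X₁ × X₂)) :
    Prop where
  isProb : IsProbabilityMeasure W
  left : ∀ S : Set X₁, MeasurableSet S → W (S ×ˢ Set.univ) = Δ S
  right : ∀ S : Set X₂, MeasurableSet S → W (Set.univ ×ˢ S) = Θ S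
  rel : 1 - δ ≤ W.real R

/-- `M₁` is `(ε, δ)`-stochastically simulated by `M₂`: there are a measurable relation `R`, a Borel
interface function `U` with values in the probability measures on the controls of `M₂`, and a Borel
stochastic kernel `W` such that related states have `ε`-close outputs, `W` lifts the transition
probabilities of related states, and the initial measures are in the lifted relation. -/
def Simulates {Y : Type v} [MetricSpace Y] [MeasurableSpace Y]
    (M₁ M₂ : GMDP.{u, v} Y) (ε δ : ℝ) : Prop :=
  ∃ (R : Set (M₁.X × M₂.X)) (U : Kernel (M₁.A × M₁.X × M₂.X) M₂.A)
    (W : Kernel (M₁.A × M₁.X × M₂.X) (M₁.X × M₂.X)),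
    MeasurableSet R ∧ IsMarkovKernel U ∧ IsMarkovKernel W ∧
    (∀ x₁ x₂, (x₁, x₂) ∈ R → dist (M₁.h x₁) (M₂.h x₂) ≤ ε) ∧
    (∀ x₁ x₂, (x₁, x₂) ∈ R → ∀ a : M₁.A,
      IsLifting R δ (M₁.T (x₁, a)) (M₂.trans x₂ (U (a, x₁, x₂))) (W (a, x₁, x₂))) ∧
    (∃ W₀, IsLifting R δ M₁.init M₂.init W₀)

/-- The Markov policy `_μ` for `M₁` `(ε, δ)`-robustly satisfies "eventually `K`" with probability
`p`: every `M₂` that simulates `M₁` has a control strategy under which `K` is eventually reached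
with probability at least `p`. The policy itself does not occur in the defining condition. -/
def RobustlyReaches {Y : Type v} [MetricSpace Y] [MeasurableSpace Y]
    (M₁ : GMDP.{u, v} Y) (K : Set Y) (ε δ : ℝ) (_μ : MarkovPolicy M₁) (p : ℝ) : Prop :=
  ∀ M₂ : GMDP.{u, v} Y, Simulates M₁ M₂ ε δ →
    ∃ (C₂ : ControlStrategy M₂) (P : Measure (ℕ → M₂.X × C₂.X)),
      IsExecutionLaw C₂ P ∧ p ≤ P.real (eventuallyReaches C₂ K)

/-- The truncation of the real line to `[0, 1]`. -/
noncomputable def trunc (r : ℝ) : ℝ := min 1 (max 0 r)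

/-- The function `1_{K_X} + 1_{X \ K_X} V` on the state space, with `K_X` the preimage of `K` under
the output map. -/
noncomputable def reachFun {Y : Type v} [MeasurableSpace Y] (M : GMDP.{u, v} Y) (K : Set Y)
    (V : M.X → ℝ) (x : M.X) : ℝ :=
  (M.h ⁻¹' K).indicator (fun _ => 1) x + (M.h ⁻¹' K)ᶜ.indicator V x

/-- The robust operator of the map `ν`. -/
noncomputable def robustOp {Y : Type v} [MeasurableSpace Y] (M : GMDP.{u, v} Y) (K : Set Y) (δ : ℝ)
    (ν : UMKernel M.X M.A) (V : M.X → ℝ) (x : M.X) : ℝ :=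
  trunc ((∫ x', reachFun M K V x' ∂(M.trans x (ν.toFun x))) - δ)

/-- The optimal robust operator: the pointwise supremum of `robustOp` over all maps `ν`. -/
noncomputable def robustOpStar {Y : Type v} [MeasurableSpace Y] (M : GMDP.{u, v} Y) (K : Set Y)
    (δ : ℝ) (V : M.X → ℝ) (x : M.X) : ℝ :=
  ⨆ ν : UMKernel M.X M.A, robustOp M K δ ν V x

/-- The pointwise limit of the iterates of an operator started at the zero function. -/
noncomputable def limitValue {X : Type u} (Op : (X → ℝ) → X → ℝ) (x : X) : ℝ :=
  limUnder atTop (fun q : ℕ => (Op^[q] 0) x)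

/-- `V` is the monotone pointwise limit of the iterates of `Op` started at zero, takes its values in
`[0, 1]` and is a fixed point of `Op`. -/
structure IsIteratedFixedPoint {X : Type u} (Op : (X → ℝ) → X → ℝ) (V : X → ℝ) : Prop where
  mem_Icc : ∀ x, V x ∈ Set.Icc (0 : ℝ) 1
  monotone : ∀ x, Monotone (fun q : ℕ => (Op^[q] 0) x)
  tendsto : ∀ x, Tendsto (fun q : ℕ => (Op^[q] 0) x) atTop (𝓝 (V x))
  fixed : Op V = V

/-- The robust value function of the time-homogeneous policy `ν`. -/
noncomputable def robustValue {Y : Type v} [MeasurableSpace Y] (M : GMDP.{u, v} Y) (K : Set Y)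
    (δ : ℝ) (ν : UMKernel M.X M.A) : M.X → ℝ :=
  limitValue (robustOp M K δ ν)

/-- The optimal robust value function. -/
noncomputable def robustValueStar {Y : Type v} [MeasurableSpace Y] (M : GMDP.{u, v} Y) (K : Set Y)
    (δ : ℝ) : M.X → ℝ :=
  limitValue (robustOpStar M K δ)

/-- The robust reachability probability of the time-homogeneous policy `ν`. -/
noncomputable def robustProb {Y : Type v} [MeasurableSpace Y] (M : GMDP.{u, v} Y) (K : Set Y)
    (δ : ℝ) (ν : UMKernel M.X M.A) : ℝ :=
  trunc ((∫ x, reachFun M K (robustValue M K δ ν) x ∂M.init) - δ)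

/-- `ν` is an optimal `(0, δ)`-robust policy: at every state it attains the supremum over all maps
of the robust operator applied to the optimal robust value function. -/
def IsOptimalRobustPolicy {Y : Type v} [MeasurableSpace Y] (M : GMDP.{u, v} Y) (K : Set Y)
    (δ : ℝ) (ν : UMKernel M.X M.A) : Prop :=
  ∀ (x : M.X) (ν' : UMKernel M.X M.A),
    robustOp M K δ ν' (robustValueStar M K δ) x ≤ robustOp M K δ ν (robustValueStar M K δ) x

/-! ### Analytic sets and their measures. -/

section Analytic

open Set

/-! Robust reachability rests on a coupling. Given a simulation `(R, U, W)` of `M₁` by `M₂`, the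
strategy for `M₂` keeps a simulated state of `M₁` in memory. It draws that state from the
conditional law, under the previous coupling, given the observed state of `M₂`, then draws a
simulated control from the policy and refines it through `U`. Averaging over the simulated state
recovers the joint law `W`. Let `coupledValue` be the robust value of the simulated state, averaged
and set to `0` off `R`. One step of `W` leaves `R` with probability at most `δ`, which is the loss
subtracted by the robust operator; outputs agree on `R` since the precision is `0`. Hence
`coupledValue` is a subsolution of the reachability recursion (`coupledValue_succ_le`) and bounds
the reachability probability (`lintegral_le_chainLaw_reach`). The initial coupling costs the last
`δ`, and the number of steps tends to infinity.

Disintegration is carried out for Borel data, so a universally measurable policy is first replaced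
by a Borel one that agrees with it almost everywhere under every state law; this leaves the robust
probability unchanged (`exists_kernel_robustProb_eq`).

The fixed points come from monotonicity and dominated convergence, once every iterate is universally
measurable. For the optimal operator this is the delicate point, since it is a supremum over
uncountably many controls. Its iterates have analytic strict hypographs: a supremum over controls is
a projection (`UpperSemianalytic.robustOpStar`), and an integral is the measure of a hypograph,
which depends on the kernel in an upper semianalytic way (`AnalyticSet.setOf_lt_kernel`). Optimality
then says that the supremum is attained at the optimal value, and the reachability claim for `μ*` is
the one for a general policy. -/

theorem MeasureTheory.AnalyticSet.union {α : Type*} [TopologicalSpace α] {s t : Set α}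
    (hs : AnalyticSet s) (ht : AnalyticSet t) : AnalyticSet (s ∪ t) := by
  rw [union_eq_iUnion]
  exact AnalyticSet.iUnion fun b => by cases b <;> assumption

theorem MeasureTheory.AnalyticSet.inter {α : Type*} [TopologicalSpace α] [T2Space α] {s t : Set α}
    (hs : AnalyticSet s) (ht : AnalyticSet t) : AnalyticSet (s ∩ t) := by
  rw [inter_eq_iInter]
  exact AnalyticSet.iInter fun b => by cases b <;> assumption

/-- The closure of the image of the sequences dominated by `s` on their first `n` terms. -/
def boundedImage {E : Type*} [TopologicalSpace E] (f : (ℕ → ℕ) → E) (n : ℕ) (s : Fin n → ℕ) :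
    Set E :=
  closure (f '' {β | ∀ i : Fin n, β i ≤ s i})

/-- Compactness of the box of sequences dominated by `α`: a point in every closure is a limit of
values `f (β n)` with `β n` dominated by `α` on its first `n` terms, and a cluster point of the `β
n` is a preimage. -/
theorem iInter_boundedImage_subset {E : Type*} [TopologicalSpace E] [T2Space E]
    [FirstCountableTopology E]
    {f : (ℕ → ℕ) → E} (hf : Continuous f) (α : ℕ → ℕ) :
    ⋂ n, boundedImage f n (fun i => α i) ⊆ range f := by
  intro y hy
  obtain ⟨U, hU⟩ := (𝓝 y).exists_antitone_basis
  have h1 : ∀ n, ∃ β : ℕ → ℕ, (∀ i < n, β i ≤ α i) ∧ f β ∈ U n := by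
    intro n
    have h2 := mem_closure_iff_nhds.1 (mem_iInter.1 hy n) (U n) (hU.1.mem_of_mem trivial)
    obtain ⟨_, hz, β, hβ, rfl⟩ := h2
    exact ⟨β, fun i hi => hβ ⟨i, hi⟩, hz⟩
  choose β hβ hβU using h1
  have hc : IsCompact (univ.pi fun i => Iic (α i)) :=
    isCompact_univ_pi fun i => (finite_Iic (α i)).isCompact
  -- Capping by `α` puts every term in the compact box. At coordinate `i` the cap is inactive once
  -- `n > i`, so the uncapped sequence has the same limit.
  obtain ⟨γ, -, φ, hφ, hlim⟩ := hc.tendsto_subseq (x := fun n i => min (β n i) (α i))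
    (fun n i _ => mem_Iic.2 (min_le_right _ _))
  have hlim' : Tendsto (β ∘ φ) atTop (𝓝 γ) := by
    rw [tendsto_pi_nhds] at hlim ⊢
    intro i
    refine (hlim i).congr' ?_
    filter_upwards [eventually_gt_atTop i] with n hn
    exact min_eq_left (hβ _ _ (hn.trans_le hφ.le_apply))
  have h3 : Tendsto (fun n => f (β n)) atTop (𝓝 y) := hU.tendsto hβU
  exact ⟨γ, tendsto_nhds_unique ((hf.tendsto γ).comp hlim') (h3.comp hφ.tendsto_atTop)⟩

/-- The bound `α` is built one coordinate at a time: the image is the increasing union over the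
bound placed on the next coordinate, so continuity from below yields a finite bound that keeps the
mass above `c`. -/
theorem exists_lt_measure_boundedImage {E : Type*} [TopologicalSpace E] [MeasurableSpace E]
    (f : (ℕ → ℕ) → E) (m : Measure E) {c : ENNReal} (hc : c < m (range f)) :
    ∃ α : ℕ → ℕ, ∀ n, c < m (boundedImage f n (fun i => α i)) := by
  let N : (ℕ → ℕ) → ℕ → Set (ℕ → ℕ) := fun α n => {β | ∀ i < n, β i ≤ α i}
  have hstep : ∀ (α : ℕ → ℕ) (n : ℕ), ∃ k, c < m (f '' N α n) →
      c < m (f '' N (Function.update α n k) (n + 1)) := by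
    intro α n
    by_cases h : c < m (f '' N α n)
    · have hU : f '' N α n = ⋃ k, f '' N (Function.update α n k) (n + 1) := by
        rw [← image_iUnion]
        congr 1
        ext β
        simp only [N, mem_ofPred_eq, mem_iUnion]
        constructor
        · intro hβ
          refine ⟨β n, fun i hi => ?_⟩
          rcases Nat.lt_succ_iff_lt_or_eq.1 hi with h | rfl
          · rw [Function.update_of_ne h.ne]; exact hβ i h
          · simp
        · rintro ⟨k, hk⟩ i hi
          have := hk i (hi.trans (Nat.lt_succ_self n))
          rwa [Function.update_of_ne hi.ne] at this
      have hmono : Monotone fun k => f '' N (Function.update α n k) (n + 1) := by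
        intro k l hkl
        refine image_mono fun β hβ i hi => (hβ i hi).trans ?_
        by_cases hin : i = n
        · subst hin; simpa using hkl
        · simp [Function.update_of_ne hin]
      rw [hU, hmono.measure_iUnion, lt_iSup_iff] at h
      exact h.imp fun k hk _ => hk
    · exact ⟨0, fun h' => absurd h' h⟩
  choose k hk using hstep
  -- Stage `n` changes only coordinate `n`, so the diagonal `g (i + 1) i` agrees with `g n` below
  -- `n`.
  let g : ℕ → ℕ → ℕ := fun n => Nat.rec 0 (fun n α => Function.update α n (k α n)) n
  have hg : ∀ n, g (n + 1) = Function.update (g n) n (k (g n) n) := fun n => rfl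
  have hgi : ∀ i n, i < n → g n i = g (i + 1) i := by
    intro i n hin
    induction n, hin using Nat.le_induction with
    | base => rfl
    | succ n hn ih => rw [hg, Function.update_of_ne (by omega), ih]
  have hlt : ∀ n, c < m (f '' N (g n) n) := by
    intro n
    induction n with
    | zero => simpa [N] using hc
    | succ n ih => rw [hg]; exact hk _ _ ih
  refine ⟨fun i => g (i + 1) i, fun n => (hlt n).trans_le (measure_mono ?_)⟩
  refine (image_mono fun β hβ i => ?_).trans subset_closure
  change β i ≤ g (i + 1) i
  rw [← hgi i n i.2]
  exact hβ i i.2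

theorem measurableSet_boundedImage {E : Type*} [TopologicalSpace E] [MeasurableSpace E]
    [OpensMeasurableSpace E] (f : (ℕ → ℕ) → E) (n : ℕ) (s : Fin n → ℕ) :
    MeasurableSet (boundedImage f n s) :=
  isClosed_closure.measurableSet

theorem antitone_boundedImage {E : Type*} [TopologicalSpace E] (f : (ℕ → ℕ) → E) (α : ℕ → ℕ) :
    Antitone fun n => boundedImage f n (fun i => α i) := fun _ _ hkl =>
  closure_mono (image_mono fun _ hβ i => hβ ⟨i, i.2.trans_le hkl⟩)

theorem le_measure_iInter_boundedImage {E : Type*} [TopologicalSpace E] [MeasurableSpace E]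
    [OpensMeasurableSpace E] (f : (ℕ → ℕ) → E) (α : ℕ → ℕ) (m : Measure E) [IsFiniteMeasure m]
    {c : ENNReal} (h : ∀ n, c ≤ m (boundedImage f n (fun i => α i))) :
    c ≤ m (⋂ n, boundedImage f n (fun i => α i)) := by
  rw [(antitone_boundedImage f α).measure_iInter
    (fun n => (measurableSet_boundedImage f n _).nullMeasurableSet) ⟨0, measure_ne_top _ _⟩]
  exact le_iInf h

/-- Analytic sets are universally measurable. -/
theorem MeasureTheory.AnalyticSet.nullMeasurableSet {E : Type*} [TopologicalSpace E] [T2Space E]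
    [FirstCountableTopology E] [MeasurableSpace E] [OpensMeasurableSpace E] {A : Set E}
    (hA : AnalyticSet A) (m : Measure E) [IsFiniteMeasure m] : NullMeasurableSet A m := by
  rw [AnalyticSet] at hA
  obtain rfl | ⟨f, hf, rfl⟩ := hA
  · exact nullMeasurableSet_empty
  have h1 : ∀ c : ENNReal, ∃ B ⊆ range f, MeasurableSet B ∧ (c < m (range f) → c ≤ m B) := by
    intro c
    by_cases hc : c < m (range f)
    · obtain ⟨α, hα⟩ := exists_lt_measure_boundedImage f m hc
      exact ⟨_, iInter_boundedImage_subset hf α,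
        MeasurableSet.iInter fun n => measurableSet_boundedImage f n _,
        fun _ => le_measure_iInter_boundedImage f α m fun n => (hα n).le⟩
    · exact ⟨∅, empty_subset _, MeasurableSet.empty, fun h => absurd h hc⟩
  choose B hBf hBm hBc using h1
  -- A countable union over a dense set of levels `c` gives one measurable subset of full mass.
  obtain ⟨S, hSc, hSd⟩ := TopologicalSpace.exists_countable_dense ENNReal
  set D : Set E := ⋃ c ∈ S, B c
  have hDm : MeasurableSet D := MeasurableSet.biUnion hSc fun c _ => hBm c
  have hDf : D ⊆ range f := iUnion₂_subset fun c _ => hBf c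
  have hDle : m (range f) ≤ m D := by
    refine le_of_forall_lt fun c hc => ?_
    obtain ⟨q, hq, hcq, hqr⟩ := hSd.exists_between hc
    exact hcq.trans_le ((hBc q hqr).trans (measure_mono (subset_biUnion_of_mem hq)))
  have hae : D =ᵐ[m] range f :=
    ae_eq_of_subset_of_measure_ge hDf hDle hDm.nullMeasurableSet (measure_ne_top _ _)
  exact hDm.nullMeasurableSet.congr hae

/-- The measure of an analytic set under a kernel is an upper semianalytic function. -/
theorem MeasureTheory.AnalyticSet.setOf_lt_kernel {Z E : Type*} [TopologicalSpace Z] [PolishSpace Z]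
    [MeasurableSpace Z] [BorelSpace Z] [TopologicalSpace E] [T2Space E]
    [FirstCountableTopology E] [MeasurableSpace E] [OpensMeasurableSpace E] {A : Set E}
    (hA : AnalyticSet A) (κ : Kernel Z E) [IsFiniteKernel κ] :
    AnalyticSet {p : Z × ENNReal | p.2 < κ p.1 A} := by
  rw [AnalyticSet] at hA
  obtain rfl | ⟨f, hf, rfl⟩ := hA
  · simpa using analyticSet_empty
  -- The witnesses are a level `q` strictly above `c` and a bounding sequence. The gap keeps the
  -- inequality strict after the limit in `n`, where only `q ≤` survives.
  let B : Set ((Z × ENNReal) × (ENNReal × (ℕ → ℕ))) :=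
    {p | p.1.2 < p.2.1} ∩ ⋂ n, {p | p.2.1 ≤ κ p.1.1 (boundedImage f n fun i => p.2.2 i)}
  have hB : MeasurableSet B := by
    refine (measurableSet_lt (by fun_prop) (by fun_prop)).inter (MeasurableSet.iInter fun n => ?_)
    refine measurableSet_le (by fun_prop) ?_
    -- Joint measurability holds because there are only countably many bounds of length `n`.
    have h1 : Measurable fun q : Z × (Fin n → ℕ) => κ q.1 (boundedImage f n q.2) :=
      measurable_from_prod_countable_left fun s =>
        κ.measurable_coe (measurableSet_boundedImage f n s)
    have h2 : Measurable fun p : (Z × ENNReal) × (ENNReal × (ℕ → ℕ)) =>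
        (p.1.1, fun i : Fin n => p.2.2 i) := by fun_prop
    exact h1.comp h2
  have himg : {p : Z × ENNReal | p.2 < κ p.1 (range f)} = Prod.fst '' B := by
    ext ⟨z, c⟩
    simp only [mem_ofPred_eq, mem_image, B, mem_inter_iff, mem_iInter]
    constructor
    · intro h
      obtain ⟨q, hcq, hq⟩ := exists_between h
      obtain ⟨α, hα⟩ := exists_lt_measure_boundedImage f (κ z) hq
      exact ⟨((z, c), (q, α)), ⟨hcq, fun n => (hα n).le⟩, rfl⟩
    · rintro ⟨⟨⟨z', c'⟩, ⟨q, α⟩⟩, ⟨hcq, hα⟩, h⟩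
      obtain ⟨rfl, rfl⟩ := Prod.mk.inj h
      exact hcq.trans_le ((le_measure_iInter_boundedImage f α _ hα).trans
        (measure_mono (iInter_boundedImage_subset hf α)))
  rw [himg]
  exact hB.analyticSet_image measurable_fst

end Analytic

/-! ### Upper semianalytic functions and their integrals. -/

/-- A real function is upper semianalytic if its strict hypograph is an analytic set. -/
def UpperSemianalytic {X : Type*} [TopologicalSpace X] (V : X → ℝ) : Prop :=
  AnalyticSet {p : X × ℝ | p.2 < V p.1}

/-- Functions with values in the unit interval that are measurable with respect to the completion
of every finite measure. -/
structure UnitUniversal {X : Type*} [MeasurableSpace X] (V : X → ℝ) : Prop where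
  mem_Icc : ∀ x, V x ∈ Set.Icc (0 : ℝ) 1
  aemeasurable : ∀ m : Measure X, IsFiniteMeasure m → AEMeasurable V m

theorem UpperSemianalytic.aemeasurable {X : Type*} [TopologicalSpace X] [PolishSpace X]
    [MeasurableSpace X] [BorelSpace X] {V : X → ℝ} (hV : UpperSemianalytic V) (m : Measure X)
    [IsFiniteMeasure m] : AEMeasurable V m := by
  refine NullMeasurable.aemeasurable ?_
  have h : @Measurable (NullMeasurableSpace X m) ℝ _ _ V := by
    refine measurable_of_Ioi fun t => ?_
    have h1 : AnalyticSet (V ⁻¹' Set.Ioi t) :=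
      AnalyticSet.preimage hV (f := fun x => (x, t)) (by fun_prop)
    exact h1.nullMeasurableSet m
  exact h

theorem volume_restrict_Ioo_Iio {v : ℝ} (hv : v ∈ Set.Icc (0 : ℝ) 1) :
    (volume.restrict (Set.Ioo (0 : ℝ) 1)) (Set.Iio v) = ENNReal.ofReal v := by
  rw [Measure.restrict_apply measurableSet_Iio]
  have : Set.Iio v ∩ Set.Ioo 0 1 = Set.Ioo 0 v := by
    ext t
    simp only [Set.mem_inter_iff, Set.mem_Iio, Set.mem_Ioo]
    exact ⟨fun h => ⟨h.2.1, h.1⟩, fun h => ⟨h.2, h.1, h.2.trans_le hv.2⟩⟩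
  rw [this, Real.volume_Ioo, sub_zero]

/-- The integral is the mass below the graph. This turns integration of an upper semianalytic
function into measuring an analytic set. -/
theorem prod_hypograph {X : Type*} [MeasurableSpace X] (m : Measure X) [IsFiniteMeasure m]
    {V : X → ℝ} (h01 : ∀ x, V x ∈ Set.Icc (0 : ℝ) 1) (hV : AEMeasurable V m) :
    (m.prod (volume.restrict (Set.Ioo (0 : ℝ) 1))) {p : X × ℝ | p.2 < V p.1}
      = ∫⁻ x, ENNReal.ofReal (V x) ∂m := by
  have hae : {p : X × ℝ | p.2 < V p.1} =ᵐ[m.prod (volume.restrict (Set.Ioo (0 : ℝ) 1))]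
      {p : X × ℝ | p.2 < hV.mk V p.1} := by
    have h1 := (Measure.quasiMeasurePreserving_fst (μ := m)
      (ν := volume.restrict (Set.Ioo (0 : ℝ) 1))).ae hV.ae_eq_mk
    filter_upwards [h1] with p hp
    change (p.2 < V p.1) = (p.2 < hV.mk V p.1)
    rw [hp]
  have hms : MeasurableSet {p : X × ℝ | p.2 < hV.mk V p.1} :=
    measurableSet_lt measurable_snd (hV.measurable_mk.comp measurable_fst)
  rw [measure_congr hae, Measure.prod_apply hms]
  refine lintegral_congr_ae ?_
  filter_upwards [hV.ae_eq_mk] with x hx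
  rw [← volume_restrict_Ioo_Iio (h01 x), hx]
  rfl

theorem UpperSemianalytic.setOf_lt_lintegral {Z X : Type*} [TopologicalSpace Z] [PolishSpace Z]
    [MeasurableSpace Z] [BorelSpace Z] [TopologicalSpace X] [PolishSpace X]
    [MeasurableSpace X] [BorelSpace X] {V : X → ℝ} (hV : UpperSemianalytic V)
    (h01 : ∀ x, V x ∈ Set.Icc (0 : ℝ) 1) (κ : Kernel Z X) [IsFiniteKernel κ] :
    AnalyticSet {p : Z × ENNReal | p.2 < ∫⁻ x, ENNReal.ofReal (V x) ∂(κ p.1)} := by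
  have h := AnalyticSet.setOf_lt_kernel hV
    (κ.prod (Kernel.const Z (volume.restrict (Set.Ioo (0 : ℝ) 1))))
  convert! h using 3 with p
  rw [Kernel.prod_apply, Kernel.const_apply, prod_hypograph _ h01 (hV.aemeasurable _)]

theorem UpperSemianalytic.unitUniversal {X : Type*} [TopologicalSpace X] [PolishSpace X]
    [MeasurableSpace X] [BorelSpace X] {V : X → ℝ} (hV : UpperSemianalytic V)
    (h01 : ∀ x, V x ∈ Set.Icc (0 : ℝ) 1) : UnitUniversal V :=
  ⟨h01, fun m _ => hV.aemeasurable m⟩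

theorem trunc_mem_Icc (r : ℝ) : trunc r ∈ Set.Icc (0 : ℝ) 1 :=
  ⟨le_min zero_le_one (le_max_left _ _), min_le_left _ _⟩

theorem trunc_mono : Monotone trunc := fun _ _ h => min_le_min le_rfl (max_le_max le_rfl h)

theorem continuous_trunc : Continuous trunc := by unfold trunc; fun_prop

theorem lt_trunc_iff {t r : ℝ} : t < trunc r ↔ t < 0 ∨ (t < 1 ∧ t < r) := by
  unfold trunc
  rw [lt_min_iff, lt_max_iff]
  constructor
  · rintro ⟨h1, h | h⟩ <;> tauto
  · rintro (h | h)
    · exact ⟨h.trans zero_lt_one, Or.inl h⟩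
    · exact ⟨h.1, Or.inr h.2⟩

/-! ### Robust operators, measurability and fixed points. -/

section Operators

variable {Y : Type v} [MeasurableSpace Y] {M : GMDP.{u, v} Y} {K : Set Y} {δ : ℝ}

theorem reachFun_of_mem {V : M.X → ℝ} {x : M.X} (hx : M.h x ∈ K) : reachFun M K V x = 1 := by
  have h1 : x ∈ M.h ⁻¹' K := hx
  simp [reachFun, h1]

theorem reachFun_of_notMem {V : M.X → ℝ} {x : M.X} (hx : M.h x ∉ K) : reachFun M K V x = V x := by
  have h1 : x ∉ M.h ⁻¹' K := hx
  simp [reachFun, h1]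

theorem reachFun_mono {V W : M.X → ℝ} (h : ∀ x, V x ≤ W x) (x : M.X) :
    reachFun M K V x ≤ reachFun M K W x := by
  by_cases hx : M.h x ∈ K
  · rw [reachFun_of_mem hx, reachFun_of_mem hx]
  · rw [reachFun_of_notMem hx, reachFun_of_notMem hx]; exact h x

theorem tendsto_reachFun {V : ℕ → M.X → ℝ} {W : M.X → ℝ}
    (h : ∀ x, Tendsto (fun q => V q x) atTop (𝓝 (W x))) (x : M.X) :
    Tendsto (fun q => reachFun M K (V q) x) atTop (𝓝 (reachFun M K W x)) := by
  by_cases hx : M.h x ∈ K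
  · simp only [reachFun_of_mem hx]; exact tendsto_const_nhds
  · simp only [reachFun_of_notMem hx]; exact h x

theorem UnitUniversal.reachFun (hK : MeasurableSet K) {V : M.X → ℝ} (hV : UnitUniversal V) :
    UnitUniversal (reachFun M K V) where
  mem_Icc x := by
    by_cases hx : M.h x ∈ K
    · rw [reachFun_of_mem hx]; simp
    · rw [reachFun_of_notMem hx]; exact hV.mem_Icc x
  aemeasurable m hm := by
    have h := hV.aemeasurable m hm
    exact (measurable_const.indicator (M.measurable_h hK)).aemeasurable.add
      (h.indicator (M.measurable_h hK).compl)

theorem UpperSemianalytic.reachFun (hK : MeasurableSet K) {V : M.X → ℝ}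
    (hV : UpperSemianalytic V) : UpperSemianalytic (reachFun M K V) := by
  have h1 : MeasurableSet {p : M.X × ℝ | M.h p.1 ∈ K} :=
    hK.preimage (M.measurable_h.comp measurable_fst)
  have h2 : MeasurableSet {p : M.X × ℝ | p.2 < 1} := measurableSet_lt (by fun_prop) (by fun_prop)
  have h3 := AnalyticSet.union (h1.inter h2).analyticSet (h1.compl.analyticSet.inter hV)
  unfold UpperSemianalytic
  convert! h3 using 1
  ext p
  by_cases hx : M.h p.1 ∈ K
  · simp [reachFun_of_mem hx, hx]
  · simp [reachFun_of_notMem hx, hx]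

theorem UnitUniversal.integrable {X : Type*} [MeasurableSpace X] {V : X → ℝ}
    (hV : UnitUniversal V) (m : Measure X) [hm : IsFiniteMeasure m] : Integrable V m :=
  Integrable.of_bound (hV.aemeasurable m hm).aestronglyMeasurable 1 <| ae_of_all _ fun x => by
    rw [Real.norm_eq_abs, abs_of_nonneg (hV.mem_Icc x).1]; exact (hV.mem_Icc x).2

theorem UnitUniversal.ofReal_integral {X : Type*} [MeasurableSpace X] {V : X → ℝ}
    (hV : UnitUniversal V) (m : Measure X) [IsFiniteMeasure m] :
    ENNReal.ofReal (∫ x, V x ∂m) = ∫⁻ x, ENNReal.ofReal (V x) ∂m :=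
  ofReal_integral_eq_lintegral_ofReal (hV.integrable m) (ae_of_all _ fun x => (hV.mem_Icc x).1)

instance isProbabilityMeasure_trans (x : M.X) (p : Measure M.A) [IsProbabilityMeasure p] :
    IsProbabilityMeasure (M.trans x p) := by
  constructor
  rw [GMDP.trans, Measure.bind_apply MeasurableSet.univ
    (by fun_prop : Measurable fun a => M.T (x, a)).aemeasurable]
  simp

instance (κ : UMKernel M.X M.A) (x : M.X) : IsProbabilityMeasure (κ.toFun x) := κ.isProb x

theorem trans_dirac (x : M.X) (a : M.A) : M.trans x (Measure.dirac a) = M.T (x, a) :=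
  Measure.dirac_bind (f := fun a => M.T (x, a)) (by fun_prop) a

/-- The kernel obtained from a transition kernel and a Borel randomised control. -/
noncomputable def transKernel (M : GMDP.{u, v} Y) {Z : Type*} [MeasurableSpace Z]
    (f : Z → M.X) (hf : Measurable f) (ν : Kernel Z M.A) : Kernel Z M.X :=
  M.T ∘ₖ (Kernel.deterministic f hf ×ₖ ν)

theorem transKernel_apply {Z : Type*} [MeasurableSpace Z] (f : Z → M.X) (hf : Measurable f)
    (ν : Kernel Z M.A) [IsSFiniteKernel ν] (z : Z) :
    transKernel M f hf ν z = M.trans (f z) (ν z) := by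
  ext s hs
  rw [transKernel, Kernel.comp_apply' _ _ _ hs, Kernel.prod_apply, Kernel.deterministic_apply,
    Measure.dirac_prod, lintegral_map (M.T.measurable_coe hs) (by fun_prop), GMDP.trans,
    Measure.bind_apply hs (by fun_prop : Measurable fun a => M.T (f z, a)).aemeasurable]

instance {Z : Type*} [MeasurableSpace Z] (f : Z → M.X) (hf : Measurable f)
    (ν : Kernel Z M.A) [IsMarkovKernel ν] : IsMarkovKernel (transKernel M f hf ν) := by
  unfold transKernel; infer_instance

/-- A Borel kernel as a universally measurable kernel. -/
noncomputable def UMKernel.ofKernel {α β : Type*} [MeasurableSpace α] [MeasurableSpace β]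
    (κ : Kernel α β) [IsMarkovKernel κ] : UMKernel α β where
  toFun := κ
  isProb := inferInstance
  umeas _ _ := κ.measurable.nullMeasurable

/-- A universally measurable kernel agrees with a Borel kernel almost everywhere. -/
theorem UMKernel.exists_kernel_ae_eq {α β : Type*} [MeasurableSpace α] [MeasurableSpace β]
    [StandardBorelSpace β] (μ : UMKernel α β) (m : Measure α) [IsFiniteMeasure m] :
    ∃ κ : Kernel α β, IsMarkovKernel κ ∧ μ.toFun =ᵐ[m] κ := by
  rcases isEmpty_or_nonempty α with hα | ⟨⟨a₀⟩⟩
  · refine ⟨Kernel.mk μ.toFun (fun s _ => by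
      convert MeasurableSet.empty; exact Set.eq_empty_of_isEmpty _), ⟨μ.isProb⟩, ?_⟩
    rfl
  have hnull := μ.umeas m inferInstance
  let S := MeasurableSpace.countableGeneratingSet β
  let P := generateSetAlgebra S
  have hPc : P.Countable := countable_generateSetAlgebra MeasurableSpace.countable_countableGeneratingSet
  have hSgen : ‹MeasurableSpace β› = MeasurableSpace.generateFrom S :=
    (MeasurableSpace.generateFrom_countableGeneratingSet).symm
  have hPgen : ‹MeasurableSpace β› = MeasurableSpace.generateFrom P := by
    rw [generateFrom_generateSetAlgebra_eq]; exact hSgen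
  have hPm : ∀ s ∈ P, MeasurableSet s := fun s hs =>
    hPgen ▸ MeasurableSpace.measurableSet_generateFrom hs
  have hae : ∀ s ∈ P, AEMeasurable (fun a => μ.toFun a s) m := fun s hs =>
    NullMeasurable.aemeasurable
      ((Measure.measurable_coe (hPm s hs)).comp_nullMeasurable hnull)
  choose! g hgm hg using hae
  -- The generating algebra is countable, so a single null set carries all the exceptions.
  -- Redefining the kernel as a constant there makes it Borel, by the π-system criterion.
  have hN : ∀ᵐ a ∂m, ∀ s ∈ P, μ.toFun a s = g s a := (ae_ball_iff hPc).2 hg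
  obtain ⟨N, hNs, hNm, hN0⟩ := exists_measurable_superset_of_null hN
  have hp := μ.isProb
  classical
  let k : α → Measure β := N.piecewise (fun _ => μ.toFun a₀) μ.toFun
  have hkp : ∀ a, IsProbabilityMeasure (k a) := fun a => by
    by_cases ha : a ∈ N
    · simp only [k, Set.piecewise_eq_of_mem _ _ _ ha]; infer_instance
    · simp only [k, Set.piecewise_eq_of_notMem _ _ _ ha]; infer_instance
  have hkm : Measurable k := by
    refine Measurable.measure_of_isPiSystem_of_isProbabilityMeasure hPgen
      isSetAlgebra_generateSetAlgebra.isSetRing.isSetSemiring.isPiSystem fun s hs => ?_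
    have : (fun a => k a s) = N.piecewise (fun _ => μ.toFun a₀ s) (g s) := by
      ext a
      by_cases ha : a ∈ N
      · simp [k, ha]
      · simp only [k, Set.piecewise_eq_of_notMem _ _ _ ha]
        by_contra hne
        exact ha (hNs fun h => hne (h s hs))
    rw [this]
    exact Measurable.piecewise hNm measurable_const (hgm s hs)
  refine ⟨⟨k, hkm⟩, ⟨hkp⟩, ?_⟩
  refine measure_mono_null (fun a ha => ?_) hN0
  by_contra haN
  have h : k a = μ.toFun a := Set.piecewise_eq_of_notMem _ _ _ haN
  exact ha h.symm

theorem aemeasurable_trans (ν : UMKernel M.X M.A) (m : Measure M.X) [IsFiniteMeasure m] :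
    AEMeasurable (fun x => M.trans x (ν.toFun x)) m := by
  obtain ⟨κ, hκ, hae⟩ := ν.exists_kernel_ae_eq m
  refine ⟨transKernel M id measurable_id κ, Kernel.measurable _, ?_⟩
  filter_upwards [hae] with x hx
  rw [transKernel_apply, hx]
  rfl

instance isFiniteMeasure_bind_trans (ν : UMKernel M.X M.A) (m : Measure M.X) [IsFiniteMeasure m] :
    IsFiniteMeasure (m.bind fun x => M.trans x (ν.toFun x)) := by
  constructor
  rw [Measure.bind_apply MeasurableSet.univ (aemeasurable_trans ν m)]
  simp

/-- Given `m` on the current states, `V` is almost everywhere measurable for the law of the next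
state, and `ν` agrees `m`-almost everywhere with a Borel kernel. -/
theorem UnitUniversal.robustOp (hK : MeasurableSet K) (ν : UMKernel M.X M.A) {V : M.X → ℝ}
    (hV : UnitUniversal V) : UnitUniversal (robustOp M K δ ν V) where
  mem_Icc _ := trunc_mem_Icc _
  aemeasurable m _ := by
    have hr := hV.reachFun hK
    have h1 : AEMeasurable (fun x => ∫⁻ y, ENNReal.ofReal (_root_.reachFun M K V y)
        ∂(M.trans x (ν.toFun x))) m := by
      have h2 := (hr.aemeasurable (m.bind fun x => M.trans x (ν.toFun x))
        inferInstance).ennreal_ofReal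
      exact (Measure.aemeasurable_lintegral h2).comp_aemeasurable (aemeasurable_trans ν m)
    have h3 : _root_.robustOp M K δ ν V = fun x =>
        trunc ((∫⁻ y, ENNReal.ofReal (_root_.reachFun M K V y)
          ∂(M.trans x (ν.toFun x))).toReal - δ) := by
      ext x
      rw [_root_.robustOp, ← hr.ofReal_integral,
        ENNReal.toReal_ofReal (integral_nonneg fun y => (hr.mem_Icc y).1)]
    rw [h3]
    exact continuous_trunc.measurable.comp_aemeasurable (h1.ennreal_toReal.sub_const δ)

theorem robustOp_mono (hK : MeasurableSet K) (ν : UMKernel M.X M.A) {V W : M.X → ℝ}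
    (hV : UnitUniversal V) (hW : UnitUniversal W) (h : ∀ x, V x ≤ W x) (x : M.X) :
    robustOp M K δ ν V x ≤ robustOp M K δ ν W x :=
  trunc_mono (sub_le_sub_right (integral_mono ((hV.reachFun hK).integrable _)
    ((hW.reachFun hK).integrable _) (reachFun_mono h)) δ)

theorem tendsto_integral_reachFun (hK : MeasurableSet K) {V : ℕ → M.X → ℝ} {W : M.X → ℝ}
    (hV : ∀ q, UnitUniversal (V q)) (h : ∀ x, Tendsto (fun q => V q x) atTop (𝓝 (W x)))
    (m : Measure M.X) [IsFiniteMeasure m] :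
    Tendsto (fun q => ∫ y, reachFun M K (V q) y ∂m) atTop (𝓝 (∫ y, reachFun M K W y ∂m)) := by
  refine tendsto_integral_of_dominated_convergence (fun _ => 1)
    (fun q => (((hV q).reachFun hK).integrable m).aestronglyMeasurable)
    (integrable_const _) (fun q => ae_of_all _ fun y => ?_)
    (ae_of_all _ fun y => tendsto_reachFun h y)
  have := ((hV q).reachFun hK).mem_Icc y
  rw [Real.norm_eq_abs, abs_of_nonneg this.1]; exact this.2

theorem tendsto_robustOp (hK : MeasurableSet K) (ν : UMKernel M.X M.A) {V : ℕ → M.X → ℝ}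
    {W : M.X → ℝ} (hV : ∀ q, UnitUniversal (V q))
    (h : ∀ x, Tendsto (fun q => V q x) atTop (𝓝 (W x))) (x : M.X) :
    Tendsto (fun q => robustOp M K δ ν (V q) x) atTop (𝓝 (robustOp M K δ ν W x)) :=
  (continuous_trunc.tendsto _).comp ((tendsto_integral_reachFun hK hV h _).sub_const δ)

theorem UnitUniversal.of_tendsto {X : Type*} [MeasurableSpace X] {V : ℕ → X → ℝ} {W : X → ℝ}
    (hV : ∀ q, UnitUniversal (V q)) (h : ∀ x, Tendsto (fun q => V q x) atTop (𝓝 (W x))) :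
    UnitUniversal W where
  mem_Icc x := isClosed_Icc.mem_of_tendsto (h x) (Eventually.of_forall fun q => (hV q).mem_Icc x)
  aemeasurable m hm := aemeasurable_of_tendsto_metrizable_ae atTop
    (fun q => (hV q).aemeasurable m hm) (ae_of_all _ h)

theorem UnitUniversal.zero {X : Type*} [MeasurableSpace X] : UnitUniversal (0 : X → ℝ) :=
  ⟨fun _ => by simp, fun _ _ => aemeasurable_const⟩

/-- The supremum of a family of robust operators has its iterates increasing to a fixed point, as
soon as the iterates are universally measurable. -/
theorem isIteratedFixedPoint_iSup (hK : MeasurableSet K) {ι : Type*} (ν : ι → UMKernel M.X M.A)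
    (Op : (M.X → ℝ) → M.X → ℝ) (hOp : ∀ V x, Op V x = ⨆ i, robustOp M K δ (ν i) V x)
    (hit : ∀ q, UnitUniversal (Op^[q] 0)) :
    IsIteratedFixedPoint Op (limitValue Op) := by
  have hbdd : ∀ V x, BddAbove (Set.range fun i => robustOp M K δ (ν i) V x) := fun V x =>
    ⟨1, by rintro _ ⟨i, rfl⟩; exact (trunc_mem_Icc _).2⟩
  have hle : ∀ V x i, robustOp M K δ (ν i) V x ≤ Op V x := fun V x i => by
    rw [hOp]; exact le_ciSup (hbdd V x) i
  have hnn : ∀ V x, 0 ≤ Op V x := fun V x => by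
    rw [hOp]; exact Real.iSup_nonneg fun i => (trunc_mem_Icc _).1
  -- Nonnegativity of `c` covers an empty index type, where the real supremum is `0`.
  have hsup : ∀ V x c, 0 ≤ c → (∀ i, robustOp M K δ (ν i) V x ≤ c) → Op V x ≤ c :=
    fun V x c hc h => by rw [hOp]; exact Real.iSup_le h hc
  have hmono : ∀ V W : M.X → ℝ, UnitUniversal V → UnitUniversal W → (∀ x, V x ≤ W x) →
      ∀ x, Op V x ≤ Op W x := fun V W hV hW h x =>
    hsup V x _ (hnn _ _) fun i => (robustOp_mono hK (ν i) hV hW h x).trans (hle W x i)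
  have hstep : ∀ q x, (Op^[q] 0) x ≤ (Op^[q + 1] 0) x := by
    intro q
    induction q with
    | zero => intro x; exact hnn _ _
    | succ q ih =>
      intro x
      rw [Function.iterate_succ_apply', Function.iterate_succ_apply' _ (q + 1)]
      exact hmono _ _ (hit q) (hit (q + 1)) ih x
  have hmon : ∀ x, Monotone fun q : ℕ => (Op^[q] 0) x := fun x =>
    monotone_nat_of_le_succ fun q => hstep q x
  have hlim : ∀ x, Tendsto (fun q : ℕ => (Op^[q] 0) x) atTop (𝓝 (limitValue Op x)) := fun x => by
    have h := tendsto_atTop_ciSup (hmon x)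
      ⟨1, by rintro _ ⟨q, rfl⟩; exact ((hit q).mem_Icc x).2⟩
    rw [limitValue, h.limUnder_eq]
    exact h
  have hV := UnitUniversal.of_tendsto hit hlim
  have hqle : ∀ q x, (Op^[q] 0) x ≤ limitValue Op x := fun q x => (hmon x).ge_of_tendsto (hlim x) q
  refine ⟨hV.mem_Icc, hmon, hlim, ?_⟩
  ext x
  refine le_antisymm (hsup _ _ _ (hV.mem_Icc x).1 fun i => ?_) ?_
  · refine le_of_tendsto' (tendsto_robustOp hK (ν i) hit hlim x) fun q => ?_
    refine (hle _ x i).trans ?_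
    rw [← Function.iterate_succ_apply' Op q]
    exact hqle _ x
  · refine le_of_tendsto' ((hlim x).comp (tendsto_add_atTop_nat 1)) fun q => ?_
    simp only [Function.comp, Function.iterate_succ_apply']
    exact hmono _ _ (hit q) hV (hqle q) x

theorem unitUniversal_iterate_robustOp (hK : MeasurableSet K) (ν : UMKernel M.X M.A) (q : ℕ) :
    UnitUniversal ((robustOp M K δ ν)^[q] 0) := by
  induction q with
  | zero => exact UnitUniversal.zero
  | succ q ih => rw [Function.iterate_succ_apply']; exact ih.robustOp hK ν

theorem isIteratedFixedPoint_robustValue (hK : MeasurableSet K) (ν : UMKernel M.X M.A) :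
    IsIteratedFixedPoint (robustOp M K δ ν) (robustValue M K δ ν) :=
  isIteratedFixedPoint_iSup (δ := δ) (ι := Unit) hK (fun _ => ν) _ (fun V x => by simp)
    (unitUniversal_iterate_robustOp hK ν)

/-- The optimal robust operator is a supremum over constant controls. -/
theorem robustOpStar_eq_iSup_control (hK : MeasurableSet K) {V : M.X → ℝ} (hV : UnitUniversal V)
    (x : M.X) :
    robustOpStar M K δ V x = ⨆ a : M.A, trunc ((∫ y, reachFun M K V y ∂(M.T (x, a))) - δ) := by
  have hr := hV.reachFun hK
  have hbdd : BddAbove (Set.range fun a : M.A =>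
      trunc ((∫ y, reachFun M K V y ∂(M.T (x, a))) - δ)) :=
    ⟨1, by rintro _ ⟨i, rfl⟩; exact (trunc_mem_Icc _).2⟩
  refine le_antisymm (Real.iSup_le (fun ν => ?_) (Real.iSup_nonneg fun a => (trunc_mem_Icc _).1))
    (Real.iSup_le (fun a => ?_) (Real.iSup_nonneg fun a => (trunc_mem_Icc _).1))
  · by_contra! hlt
    set s := ⨆ a : M.A, trunc ((∫ y, reachFun M K V y ∂(M.T (x, a))) - δ) with hs
    have hs0 : 0 ≤ s := Real.iSup_nonneg fun a => (trunc_mem_Icc _).1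
    obtain h | ⟨h1, h2⟩ := lt_trunc_iff.1 hlt
    · exact absurd h hs0.not_gt
    -- Since `s < 1`, truncation cannot hide a control whose integral exceeds `s + δ`. A randomised
    -- control only averages these integrals, so it cannot exceed the bound either.
    have h3 : ∀ a, ∫ y, reachFun M K V y ∂(M.T (x, a)) ≤ s + δ := fun a => by
      by_contra! h4
      have h5 : s < trunc ((∫ y, reachFun M K V y ∂(M.T (x, a))) - δ) :=
        lt_trunc_iff.2 (Or.inr ⟨h1, by linarith⟩)
      exact absurd (le_ciSup hbdd a) h5.not_ge
    have h6 : ENNReal.ofReal (∫ y, reachFun M K V y ∂(M.trans x (ν.toFun x)))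
        ≤ ENNReal.ofReal (s + δ) := by
      rw [hr.ofReal_integral, GMDP.trans, Measure.lintegral_bind
        (by fun_prop : Measurable fun a => M.T (x, a)).aemeasurable
        (hr.aemeasurable _ (by
          change IsFiniteMeasure (M.trans x (ν.toFun x)); infer_instance)).ennreal_ofReal]
      calc _ ≤ ∫⁻ _, ENNReal.ofReal (s + δ) ∂(ν.toFun x) := by
            refine lintegral_mono fun a => ?_
            rw [← hr.ofReal_integral]
            exact ENNReal.ofReal_le_ofReal (h3 a)
        _ = ENNReal.ofReal (s + δ) := by simp
    have h7 : 0 ≤ ∫ y, reachFun M K V y ∂(M.trans x (ν.toFun x)) :=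
      integral_nonneg fun y => (hr.mem_Icc y).1
    obtain ⟨a⟩ : Nonempty M.A := nonempty_of_isProbabilityMeasure (ν.toFun x)
    have h8 : 0 ≤ s + δ := (integral_nonneg fun y => (hr.mem_Icc y).1).trans (h3 a)
    have := (ENNReal.ofReal_le_ofReal_iff h8).1 h6
    linarith
  · have h : trunc ((∫ y, reachFun M K V y ∂(M.T (x, a))) - δ) =
        robustOp M K δ (UMKernel.ofKernel (Kernel.const M.X (Measure.dirac a))) V x := by
      have h1 : (UMKernel.ofKernel (Kernel.const M.X (Measure.dirac a))).toFun x =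
          Measure.dirac a := Kernel.const_apply _ _
      rw [robustOp, h1, trans_dirac]
    rw [h]
    exact le_ciSup (f := fun ν => robustOp M K δ ν V x)
      ⟨1, by rintro _ ⟨i, rfl⟩; exact (trunc_mem_Icc _).2⟩ _

/-- For levels `t ≥ 0`, exceeding `t` means that some control does so, hence the strict hypograph is
a projection along the controls of an analytic set. -/
theorem UpperSemianalytic.robustOpStar (hK : MeasurableSet K) {V : M.X → ℝ}
    (hV : UpperSemianalytic V) (h01 : ∀ x, V x ∈ Set.Icc (0 : ℝ) 1) :
    UpperSemianalytic (robustOpStar M K δ V) := by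
  have hU := hV.unitUniversal h01
  have hr := hU.reachFun hK
  have hneg : MeasurableSet {p : M.X × ℝ | p.2 < 0} :=
    measurableSet_lt (by fun_prop) (by fun_prop)
  have hA := (hV.reachFun hK).setOf_lt_lintegral hr.mem_Icc M.T
  have hB : AnalyticSet {p : (M.X × ℝ) × M.A |
      ENNReal.ofReal (p.1.2 + δ) < ∫⁻ y, ENNReal.ofReal (_root_.reachFun M K V y)
        ∂(M.T (p.1.1, p.2))} :=
    hA.preimage (f := fun p : (M.X × ℝ) × M.A => ((p.1.1, p.2), ENNReal.ofReal (p.1.2 + δ)))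
      (Continuous.prodMk (by fun_prop) (ENNReal.continuous_ofReal.comp (by fun_prop)))
  have hC : MeasurableSet {p : (M.X × ℝ) × M.A | p.1.2 < 1} :=
    measurableSet_lt (by fun_prop) (by fun_prop)
  -- The case `t + δ < 0` is separate because `ENNReal.ofReal` sends it to `0`, and `0` need not be
  -- strictly below the integral.
  have hD : MeasurableSet {p : (M.X × ℝ) × M.A | p.1.2 + δ < 0} :=
    measurableSet_lt (by fun_prop) (by fun_prop)
  have hE := hneg.analyticSet.union ((hC.analyticSet.inter (hD.analyticSet.union hB)).image_of_continuous
    continuous_fst)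
  unfold UpperSemianalytic
  convert! hE using 1
  ext ⟨x, t⟩
  have key : ∀ a, t < (∫ y, _root_.reachFun M K V y ∂(M.T (x, a))) - δ ↔ (t + δ < 0 ∨
      ENNReal.ofReal (t + δ) < ∫⁻ y, ENNReal.ofReal (_root_.reachFun M K V y) ∂(M.T (x, a))) := by
    intro a
    have hnn : 0 ≤ ∫ y, _root_.reachFun M K V y ∂(M.T (x, a)) :=
      integral_nonneg fun y => (hr.mem_Icc y).1
    rw [← hr.ofReal_integral]
    rcases lt_or_ge (t + δ) 0 with h | h
    · simp only [h, true_or, iff_true]; linarith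
    · rw [ENNReal.ofReal_lt_ofReal_iff_of_nonneg h, lt_sub_iff_add_lt]
      exact ⟨Or.inr, fun h' => h'.resolve_left h.not_gt⟩
  simp only [Set.mem_ofPred_eq, Set.mem_union, Set.mem_image, Set.mem_inter_iff]
  rw [robustOpStar_eq_iSup_control hK hU]
  have hnn : 0 ≤ ⨆ a : M.A, trunc ((∫ y, _root_.reachFun M K V y ∂(M.T (x, a))) - δ) :=
    Real.iSup_nonneg fun a => (trunc_mem_Icc _).1
  rcases lt_or_ge t 0 with ht | ht
  · simp only [ht, true_or, iff_true]; exact ht.trans_le hnn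
  have hbdd : BddAbove (Set.range fun a : M.A =>
      trunc ((∫ y, _root_.reachFun M K V y ∂(M.T (x, a))) - δ)) :=
    ⟨1, by rintro _ ⟨i, rfl⟩; exact (trunc_mem_Icc _).2⟩
  constructor
  · intro h
    right
    by_contra! hcon
    refine absurd h (Real.iSup_le (fun a => ?_) ht).not_gt
    by_contra! h4
    obtain h5 | ⟨h5, h6⟩ := lt_trunc_iff.1 h4
    · exact absurd h5 ht.not_gt
    · exact hcon ((x, t), a) ⟨h5, (key a).1 h6⟩ rfl
  · rintro (h | ⟨⟨⟨x', t'⟩, a⟩, ⟨h5, h6⟩, h7⟩)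
    · exact absurd h ht.not_gt
    · obtain ⟨rfl, rfl⟩ := Prod.mk.inj h7
      exact (lt_trunc_iff.2 (Or.inr ⟨h5, (key a).2 h6⟩)).trans_le (le_ciSup hbdd a)

theorem robustOpStar_mem_Icc (V : M.X → ℝ) (x : M.X) :
    robustOpStar M K δ V x ∈ Set.Icc (0 : ℝ) 1 :=
  ⟨Real.iSup_nonneg fun _ => (trunc_mem_Icc _).1,
    Real.iSup_le (fun _ => (trunc_mem_Icc _).2) zero_le_one⟩

/-- The induction carries upper semianalyticity because universal measurability alone need not
survive the supremum over controls. -/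
theorem upperSemianalytic_iterate_robustOpStar (hK : MeasurableSet K) (q : ℕ) :
    UpperSemianalytic ((robustOpStar M K δ)^[q] 0) ∧
      ∀ x, ((robustOpStar M K δ)^[q] 0) x ∈ Set.Icc (0 : ℝ) 1 := by
  induction q with
  | zero =>
    refine ⟨?_, fun x => by simp⟩
    exact MeasurableSet.analyticSet (measurableSet_lt measurable_snd measurable_const)
  | succ q ih =>
    rw [Function.iterate_succ_apply']
    exact ⟨ih.1.robustOpStar hK ih.2, robustOpStar_mem_Icc _⟩

theorem isIteratedFixedPoint_robustValueStar (hK : MeasurableSet K) :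
    IsIteratedFixedPoint (robustOpStar M K δ) (robustValueStar M K δ) :=
  isIteratedFixedPoint_iSup hK id _ (fun _ _ => rfl) fun q =>
    (upperSemianalytic_iterate_robustOpStar hK q).1.unitUniversal
      (upperSemianalytic_iterate_robustOpStar hK q).2

theorem IsOptimalRobustPolicy.robustOp_eq (hK : MeasurableSet K) {μ : UMKernel M.X M.A}
    (hμ : IsOptimalRobustPolicy M K δ μ) :
    robustOp M K δ μ (robustValueStar M K δ) = robustValueStar M K δ := by
  have hfix := (isIteratedFixedPoint_robustValueStar (M := M) (δ := δ) hK).fixed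
  ext x
  conv_rhs => rw [← hfix]
  refine le_antisymm (le_ciSup (f := fun ν => robustOp M K δ ν (robustValueStar M K δ) x)
      ⟨1, by rintro _ ⟨i, rfl⟩; exact (trunc_mem_Icc _).2⟩ μ) ?_
  exact Real.iSup_le (fun ν => hμ x ν) (trunc_mem_Icc _).1

end Operators

/-! ### Replacing a policy by a Borel policy. -/

section BorelReduction

variable {Y : Type v} [MeasurableSpace Y] {M : GMDP.{u, v} Y} {K : Set Y} {δ : ℝ}

/-- The state distributions of `M` under a time-homogeneous Markov policy. -/
noncomputable def stateLaw (M : GMDP.{u, v} Y) (μ : UMKernel M.X M.A) : ℕ → Measure M.X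
  | 0 => M.init
  | n + 1 => (stateLaw M μ n).bind fun x => M.trans x (μ.toFun x)

instance isFiniteMeasure_stateLaw (μ : UMKernel M.X M.A) (n : ℕ) :
    IsFiniteMeasure (stateLaw M μ n) := by
  induction n with
  | zero => unfold stateLaw; infer_instance
  | succ n ih => unfold stateLaw; infer_instance

theorem stateLaw_zero (μ : UMKernel M.X M.A) : stateLaw M μ 0 = M.init := rfl

theorem stateLaw_succ (μ : UMKernel M.X M.A) (n : ℕ) :
    stateLaw M μ (n + 1) = (stateLaw M μ n).bind fun x => M.trans x (μ.toFun x) := rfl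

theorem integral_reachFun_congr_ae {V W : M.X → ℝ} {m : Measure M.X} (h : ∀ᵐ x ∂m, V x = W x) :
    ∫ x, reachFun M K V x ∂m = ∫ x, reachFun M K W x ∂m := by
  refine integral_congr_ae ?_
  filter_upwards [h] with y hy
  by_cases hyK : M.h y ∈ K
  · rw [reachFun_of_mem hyK, reachFun_of_mem hyK]
  · rw [reachFun_of_notMem hyK, reachFun_of_notMem hyK, hy]

/-- An iterate at time `k` reads the previous one only through the law at time `k + 1`, so the
induction on `q` treats all `k` together. -/
theorem iterate_robustOp_ae_eq {μ ν : UMKernel M.X M.A}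
    (h : ∀ k, ∀ᵐ x ∂(stateLaw M μ k), μ.toFun x = ν.toFun x) (q : ℕ) :
    ∀ k, ∀ᵐ x ∂(stateLaw M μ k),
      ((robustOp M K δ μ)^[q] 0) x = ((robustOp M K δ ν)^[q] 0) x := by
  induction q with
  | zero => exact fun k => ae_of_all _ fun x => by rw [Function.iterate_zero, Function.iterate_zero]
  | succ q ih =>
    intro k
    have h0 := ih (k + 1)
    rw [stateLaw_succ] at h0
    have h1 := Measure.ae_ae_of_ae_bind (aemeasurable_trans μ (stateLaw M μ k)) h0
    filter_upwards [h1, h k] with x hx hx'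
    rw [Function.iterate_succ_apply', Function.iterate_succ_apply']
    rw [robustOp, robustOp, ← hx', integral_reachFun_congr_ae hx]

theorem robustProb_congr_ae (hK : MeasurableSet K) {μ ν : UMKernel M.X M.A}
    (h : ∀ k, ∀ᵐ x ∂(stateLaw M μ k), μ.toFun x = ν.toFun x) :
    robustProb M K δ μ = robustProb M K δ ν := by
  have hV : ∀ᵐ x ∂M.init, robustValue M K δ μ x = robustValue M K δ ν x := by
    have hq := fun q => iterate_robustOp_ae_eq (K := K) (δ := δ) h q 0
    rw [stateLaw_zero] at hq
    filter_upwards [ae_all_iff.2 hq] with x hx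
    exact tendsto_nhds_unique ((isIteratedFixedPoint_robustValue hK μ).tendsto x)
      (((isIteratedFixedPoint_robustValue hK ν).tendsto x).congr fun q => (hx q).symm)
  unfold robustProb
  rw [integral_reachFun_congr_ae hV]

/-- Every universally measurable policy can be replaced by a Borel policy with the same robust
reachability probability. -/
theorem exists_kernel_robustProb_eq (hK : MeasurableSet K) (μ : UMKernel M.X M.A) :
    ∃ (ν : Kernel M.X M.A) (_ : IsMarkovKernel ν),
      robustProb M K δ μ = robustProb M K δ (UMKernel.ofKernel ν) := by
  -- The sum of all state laws is infinite; `toFinite` gives a finite measure with the same null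
  -- sets.
  obtain ⟨ν, hν, hae⟩ := μ.exists_kernel_ae_eq (Measure.sum (stateLaw M μ)).toFinite
  refine ⟨ν, hν, robustProb_congr_ae hK ?_⟩
  rw [EventuallyEq, ae_toFinite] at hae
  exact Measure.ae_sum_iff.1 hae

end BorelReduction

/-! ### Reachability bounds for Markov chains. -/

section Chain

variable {S : Type*} [MeasurableSpace S]

/-- The law of the homogeneous Markov chain with initial law `ρ` and transition kernel `κ`. -/
noncomputable def chainLaw (ρ : Measure S) (κ : Kernel S S) [IsMarkovKernel κ] :
    Measure (ℕ → S) :=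
  Kernel.trajMeasure (X := fun _ => S) ρ fun n =>
    κ.comap (fun w : (i : Finset.Iic n) → S => w ⟨n, Finset.mem_Iic.2 le_rfl⟩) (by fun_prop)

variable (ρ : Measure S) (κ : Kernel S S) [IsMarkovKernel κ]

instance [IsProbabilityMeasure ρ] : IsProbabilityMeasure (chainLaw ρ κ) := by
  unfold chainLaw; infer_instance

theorem chainLaw_map_zero : (chainLaw ρ κ).map (fun ω => ω 0) = ρ := by
  unfold chainLaw Kernel.trajMeasure
  rw [Measure.map_comp _ _ (by fun_prop)]
  have h1 : (fun ω : ℕ → S => ω 0) =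
      (fun w : (i : Finset.Iic 0) → S => w ⟨0, Finset.mem_Iic.2 le_rfl⟩) ∘
        Preorder.frestrictLe (π := fun _ => S) 0 := rfl
  rw [h1, Kernel.map_comp_right _ (Preorder.measurable_frestrictLe 0) (by fun_prop), Kernel.traj_map_frestrictLe,
    Kernel.partialTraj_self, Kernel.id_map (by fun_prop), Measure.deterministic_comp_eq_map,
    Measure.map_map (by fun_prop) (by fun_prop)]
  exact Measure.map_id

theorem lintegral_chainLaw_succ [IsProbabilityMeasure ρ] {n : ℕ} {g : ((Finset.Iic n) → S) × S → ENNReal}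
    (hg : Measurable g) :
    ∫⁻ ω, g (fun i => ω i, ω (n + 1)) ∂(chainLaw ρ κ)
      = ∫⁻ ω, ∫⁻ s, g (fun i => ω i, s) ∂(κ (ω n)) ∂(chainLaw ρ κ) := by
  have h := Kernel.map_frestrictLe_trajMeasure_compProd_eq_map_trajMeasure (X := fun _ => S)
    (μ₀ := ρ) (κ := fun n =>
      κ.comap (fun w : (i : Finset.Iic n) → S => w ⟨n, Finset.mem_Iic.2 le_rfl⟩) (by fun_prop))
    (a := n)
  have h2 := congrArg (fun m => ∫⁻ p, g p ∂m) h
  rw [Measure.lintegral_compProd hg, lintegral_map hg (by fun_prop),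
    lintegral_map (by fun_prop) (by fun_prop)] at h2
  exact h2.symm

variable {ρ κ}

/-- A sequence of functions dominated by the one-step recursion of the reachability probability
bounds the reachability probability from below. -/
theorem lintegral_le_chainLaw_reach [IsProbabilityMeasure ρ] {H : Set S} (hH : MeasurableSet H) {v : ℕ → S → ENNReal}
    (hv : ∀ j, Measurable (v j)) (h0 : ∀ s, v 0 s ≤ H.indicator 1 s)
    (hsucc : ∀ j s, v (j + 1) s ≤ H.indicator 1 s + Hᶜ.indicator (fun s => ∫⁻ s', v j s' ∂(κ s)) s)
    (j : ℕ) :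
    ∫⁻ s, v j s ∂ρ ≤ chainLaw ρ κ {ω | ∃ t, ω t ∈ H} := by
  -- `N n` is the event that `H` is not visited strictly before time `n`.
  let N : ℕ → Set (ℕ → S) := fun n => {ω | ∀ t < n, ω t ∉ H}
  have hN : ∀ n, MeasurableSet (N n) := fun n => by
    have : N n = ⋂ t, ⋂ (_ : t < n), (fun ω : ℕ → S => ω t) ⁻¹' Hᶜ := by
      ext ω; simp [N]
    rw [this]
    exact MeasurableSet.iInter fun t => MeasurableSet.iInter fun _ =>
      hH.compl.preimage (measurable_pi_apply t)
  -- Markov property: avoiding `H` also at time `n` turns `N n` into `N (n + 1)`.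
  have hstep : ∀ n (g : S → ENNReal), Measurable g →
      ∫⁻ ω in N n, Hᶜ.indicator (fun s => ∫⁻ s', g s' ∂(κ s)) (ω n) ∂(chainLaw ρ κ)
        = ∫⁻ ω in N (n + 1), g (ω (n + 1)) ∂(chainLaw ρ κ) := by
    intro n g hg
    let B : Set ((Finset.Iic n) → S) := ⋂ i, (fun w => w i) ⁻¹' Hᶜ
    have hB : MeasurableSet B := MeasurableSet.iInter fun i =>
      hH.compl.preimage (measurable_pi_apply i)
    have hmemB : ∀ ω : ℕ → S, (fun i : Finset.Iic n => ω i) ∈ B ↔ ω ∈ N (n + 1) := fun ω => by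
      simp only [B, N, Set.mem_iInter, Set.mem_preimage, Set.mem_compl_iff, Set.mem_ofPred_eq,
        Subtype.forall, Finset.mem_Iic, Nat.lt_succ_iff]
    have hmem : ∀ ω : ℕ → S, ω ∈ N (n + 1) ↔ ω ∈ N n ∧ ω n ∉ H := fun ω => by
      simp only [N, Set.mem_ofPred_eq, Nat.lt_succ_iff_lt_or_eq]
      exact ⟨fun h => ⟨fun t ht => h t (Or.inl ht), h n (Or.inr rfl)⟩,
        fun h t ht => ht.elim (h.1 t) fun e => e ▸ h.2⟩
    have h := lintegral_chainLaw_succ ρ κ (n := n)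
      (g := fun p => B.indicator (fun _ => g p.2) p.1)
      (by
        have : (fun p : ((Finset.Iic n) → S) × S => B.indicator (fun _ => g p.2) p.1) =
            (Prod.fst ⁻¹' B).indicator fun p => g p.2 := by
          ext p; by_cases hp : p.1 ∈ B <;> simp [hp]
        rw [this]
        exact (hg.comp measurable_snd).indicator (hB.preimage measurable_fst))
    rw [← lintegral_indicator (hN n), ← lintegral_indicator (hN (n + 1))]
    have hl : ∀ ω : ℕ → S, (N (n + 1)).indicator (fun ω => g (ω (n + 1))) ω =
        B.indicator (fun _ => g (ω (n + 1))) (fun i : Finset.Iic n => ω i) := fun ω => by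
      by_cases hω : ω ∈ N (n + 1)
      · rw [Set.indicator_of_mem hω, Set.indicator_of_mem ((hmemB ω).2 hω)]
      · rw [Set.indicator_of_notMem hω, Set.indicator_of_notMem fun h => hω ((hmemB ω).1 h)]
    rw [lintegral_congr hl, h]
    refine lintegral_congr fun ω => ?_
    by_cases hω : ω ∈ N (n + 1)
    · have h2 := (hmem ω).1 hω
      simp only [Set.indicator_of_mem ((hmemB ω).2 hω)]
      rw [Set.indicator_of_mem h2.1, Set.indicator_of_mem (by exact h2.2)]
    · simp only [Set.indicator_of_notMem fun h => hω ((hmemB ω).1 h), lintegral_zero]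
      by_cases h1 : ω ∈ N n
      · have h2 : ω n ∈ H := by by_contra h2; exact hω ((hmem ω).2 ⟨h1, h2⟩)
        rw [Set.indicator_of_mem h1, Set.indicator_of_notMem (by simpa using h2)]
      · rw [Set.indicator_of_notMem h1]
  have hHn : ∀ n, MeasurableSet {ω : ℕ → S | ω n ∈ H} := fun n =>
    hH.preimage (measurable_pi_apply n)
  have hfirst : ∀ n, ∫⁻ ω in N n, H.indicator 1 (ω n) ∂(chainLaw ρ κ)
      = chainLaw ρ κ (N n ∩ {ω : ℕ → S | ω n ∈ H}) := fun n => by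
    have : ∀ ω : ℕ → S, H.indicator (1 : S → ENNReal) (ω n) =
        ({ω : ℕ → S | ω n ∈ H}).indicator 1 ω := fun ω => by
      by_cases h : ω n ∈ H <;> simp [h]
    rw [lintegral_congr this, lintegral_indicator_one (hHn n), Measure.restrict_apply (hHn n),
      Set.inter_comm]
  -- One step lowers `j` and raises `n`, so `n` stays general in the induction on `j`. The two terms
  -- of the recursion count disjoint events: a first visit at time `n`, and a later one.
  have main : ∀ j n, ∫⁻ ω in N n, v j (ω n) ∂(chainLaw ρ κ)
      ≤ chainLaw ρ κ (N n ∩ {ω : ℕ → S | ∃ t, ω t ∈ H}) := by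
    intro j
    induction j with
    | zero =>
      intro n
      refine (lintegral_mono fun ω : ℕ → S => h0 (ω n)).trans ?_
      rw [hfirst]
      exact measure_mono fun ω hω => ⟨hω.1, n, hω.2⟩
    | succ j ih =>
      intro n
      refine (lintegral_mono fun ω : ℕ → S => hsucc j (ω n)).trans ?_
      have hm : Measurable fun ω : ℕ → S => H.indicator (1 : S → ENNReal) (ω n) :=
        (measurable_one.indicator hH).comp (measurable_pi_apply n)
      rw [lintegral_add_left hm, hfirst,
        hstep n _ (hv j)]
      refine (add_le_add_right (ih (n + 1)) _).trans ?_
      rw [← measure_union' ?_ ((hN n).inter (hHn n))]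
      · refine measure_mono ?_
        rintro ω (hω | hω)
        · exact ⟨hω.1, n, hω.2⟩
        · exact ⟨fun t ht => hω.1 t (ht.trans (Nat.lt_succ_self n)), hω.2⟩
      · rw [Set.disjoint_left]
        exact fun ω hω hω' => hω'.1 n (Nat.lt_succ_self n) hω.2
  have h := main j 0
  have hN0 : N 0 = Set.univ := by ext; simp [N]
  rw [hN0, Measure.restrict_univ, Set.univ_inter] at h
  refine le_trans (le_of_eq ?_) h
  conv_lhs => rw [← chainLaw_map_zero ρ κ]
  rw [lintegral_map (hv j) (measurable_pi_apply 0)]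

end Chain

/-! ### The controlled system as a Markov chain. -/

section Execution

variable {Y : Type v} [MeasurableSpace Y] {M : GMDP.{u, v} Y}

/-- The one-step transition kernel of the controlled system for a Borel control strategy, given by
its memory update and its output map. -/
noncomputable def stepKernel {C : Type*} [MeasurableSpace C] (Upd : Kernel (C × M.X) C)
    (Out : Kernel C M.A) : Kernel (M.X × C) (M.X × C) :=
  -- The memory is drawn first and the state then uses the new memory, so the composition produces
  -- the pair in reverse order.
  ((Upd.comap Prod.swap measurable_swap) ⊗ₖ
    (transKernel M (fun p : (M.X × C) × C => p.1.1) (by fun_prop)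
      (Out.comap Prod.snd measurable_snd))).map Prod.swap

instance {C : Type*} [MeasurableSpace C] (Upd : Kernel (C × M.X) C) (Out : Kernel C M.A)
    [IsMarkovKernel Upd] [IsMarkovKernel Out] : IsMarkovKernel (stepKernel (M := M) Upd Out) := by
  unfold stepKernel
  exact Kernel.IsMarkovKernel.map _ measurable_swap

theorem lintegral_stepKernel {C : Type*} [MeasurableSpace C] (Upd : Kernel (C × M.X) C)
    (Out : Kernel C M.A) [IsMarkovKernel Upd] [IsMarkovKernel Out] {f : M.X × C → ENNReal}
    (hf : Measurable f) (s : M.X × C) :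
    ∫⁻ p, f p ∂(stepKernel Upd Out s) =
      ∫⁻ c, ∫⁻ x, f (x, c) ∂(M.trans s.1 (Out c)) ∂(Upd (s.2, s.1)) := by
  have hf' : Measurable fun p : C × M.X => f p.swap := hf.comp measurable_swap
  rw [stepKernel, Kernel.map_apply _ measurable_swap, lintegral_map hf measurable_swap,
    Kernel.lintegral_compProd _ _ _ hf', Kernel.comap_apply]
  refine lintegral_congr fun c => ?_
  rw [transKernel_apply, Kernel.comap_apply]
  rfl

theorem stepProb_eq_stepKernel (C : ControlStrategy M) (Upd : Kernel (C.X × M.X) C.X)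
    (Out : Kernel C.X M.A) [IsMarkovKernel Upd] [IsMarkovKernel Out] (hUpd : C.T.toFun = Upd)
    (hOut : C.h.toFun = Out) (s : M.X × C.X) {D : Set M.X} {E : Set C.X} (hD : MeasurableSet D)
    (hE : MeasurableSet E) : stepProb C s D E = stepKernel Upd Out s (D ×ˢ E) := by
  rw [← lintegral_indicator_one (hD.prod hE),
    lintegral_stepKernel _ _ (measurable_one.indicator (hD.prod hE)), stepProb, hUpd, hOut,
    ← lintegral_indicator hE]
  refine lintegral_congr fun c => ?_
  by_cases hc : c ∈ E
  · rw [Set.indicator_of_mem hc, ← lintegral_indicator_one hD]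
    refine lintegral_congr fun x => ?_
    by_cases hx : x ∈ D <;> simp [hx, hc]
  · rw [Set.indicator_of_notMem hc]
    simp [hc]

/-- The controlled system under a Borel control strategy is a Markov chain. -/
theorem isExecutionLaw_chainLaw (C : ControlStrategy M) (Upd : Kernel (C.X × M.X) C.X)
    (Out : Kernel C.X M.A) [IsMarkovKernel Upd] [IsMarkovKernel Out] (hUpd : C.T.toFun = Upd)
    (hOut : C.h.toFun = Out) :
    IsExecutionLaw C (chainLaw (M.init.prod (Measure.dirac C.x0)) (stepKernel Upd Out)) where
  isProb := inferInstance
  initial := chainLaw_map_zero _ _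
  step n B D E hB hD hE := by
    set P := chainLaw (M.init.prod (Measure.dirac C.x0)) (stepKernel Upd Out)
    have hS : MeasurableSet (B ×ˢ (D ×ˢ E)) := hB.prod (hD.prod hE)
    have hset : MeasurableSet {ω : ℕ → M.X × C.X | (fun i : Finset.Iic n => ω i) ∈ B ∧
        (ω (n + 1)).1 ∈ D ∧ (ω (n + 1)).2 ∈ E} :=
      hS.preimage (f := fun ω : ℕ → M.X × C.X => ((fun i : Finset.Iic n => ω i), ω (n + 1)))
        (by fun_prop)
    have hsetB : MeasurableSet {ω : ℕ → M.X × C.X | (fun i : Finset.Iic n => ω i) ∈ B} :=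
      hB.preimage (f := fun ω : ℕ → M.X × C.X => fun i : Finset.Iic n => ω i) (by fun_prop)
    have h := lintegral_chainLaw_succ (M.init.prod (Measure.dirac C.x0)) (stepKernel Upd Out)
      (n := n) (g := (B ×ˢ (D ×ˢ E)).indicator 1) (measurable_one.indicator hS)
    rw [← lintegral_indicator_one hset, ← lintegral_indicator hsetB]
    refine (Eq.trans ?_ h).trans ?_
    · rfl
    · refine lintegral_congr fun ω => ?_
      by_cases hω : (fun i : Finset.Iic n => ω i) ∈ B
      · rw [Set.indicator_of_mem (by exact hω), stepProb_eq_stepKernel C Upd Out hUpd hOut _ hD hE,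
          ← lintegral_indicator_one (hD.prod hE)]
        refine lintegral_congr fun s => ?_
        by_cases hs : s ∈ D ×ˢ E
        · rw [Set.indicator_of_mem hs, Set.indicator_of_mem (Set.mk_mem_prod hω hs)]
          rfl
        · rw [Set.indicator_of_notMem hs, Set.indicator_of_notMem fun h => hs h.2]
      · rw [Set.indicator_of_notMem (by exact hω)]
        have : ∀ s, (B ×ˢ (D ×ˢ E)).indicator
            (1 : ((Finset.Iic n → M.X × C.X) × (M.X × C.X)) → ENNReal) ((fun i : Finset.Iic n => ω i), s) = 0 := fun s =>
          Set.indicator_of_notMem (fun h => hω h.1) _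
        simp [this]

end Execution

/-! ### Liftings and disintegration. -/

section Lifting

variable {X₁ X₂ : Type*} [MeasurableSpace X₁] [MeasurableSpace X₂] {R : Set (X₁ × X₂)} {δ : ℝ}
  {Δ : Measure X₁} {Θ : Measure X₂} {W : Measure (X₁ × X₂)}

theorem IsLifting.map_fst (h : IsLifting R δ Δ Θ W) : W.map Prod.fst = Δ := by
  ext s hs
  rw [Measure.map_apply measurable_fst hs, ← h.left s hs, Set.prod_univ]

theorem IsLifting.map_snd (h : IsLifting R δ Δ Θ W) : W.map Prod.snd = Θ := by
  ext s hs
  rw [Measure.map_apply measurable_snd hs, ← h.right s hs, Set.univ_prod]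

theorem IsLifting.measure_compl_le (h : IsLifting R δ Δ Θ W) (hR : MeasurableSet R) :
    W Rᶜ ≤ ENNReal.ofReal δ := by
  have := h.isProb
  rw [← ofReal_measureReal, probReal_compl_eq_one_sub hR]
  exact ENNReal.ofReal_le_ofReal (by linarith [h.rel])

theorem IsLifting.deficit_nonneg (h : IsLifting R δ Δ Θ W) : 0 ≤ δ := by
  have := h.isProb
  have h1 : W.real R ≤ 1 := measureReal_le_one
  linarith [h.rel]

/-- Integrating over the first marginal costs at most the deficit compared with the part of the
lifting that lies in the relation. -/
theorem IsLifting.lintegral_le (h : IsLifting R δ Δ Θ W) (hR : MeasurableSet R) {f : X₁ → ENNReal}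
    (hf : Measurable f) (hf1 : ∀ x, f x ≤ 1) :
    ∫⁻ x, f x ∂Δ ≤ ∫⁻ p, R.indicator (fun p => f p.1) p ∂W + ENNReal.ofReal δ := by
  rw [← h.map_fst, lintegral_map hf measurable_fst]
  have hfm : Measurable fun p : X₁ × X₂ => f p.1 := hf.comp measurable_fst
  calc ∫⁻ p, f p.1 ∂W
      ≤ ∫⁻ p, (R.indicator (fun p => f p.1) p + Rᶜ.indicator 1 p) ∂W := by
        refine lintegral_mono fun p => ?_
        by_cases hp : p ∈ R
        · simp [hp]
        · simpa [hp] using hf1 p.1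
    _ = ∫⁻ p, R.indicator (fun p => f p.1) p ∂W + W Rᶜ := by
        rw [lintegral_add_left (hfm.indicator hR), lintegral_indicator_one hR.compl]
    _ ≤ _ := add_le_add_right (h.measure_compl_le hR) _

/-- `condKernel` conditions on the first coordinate; the swap conditions on the observed state of
the second system instead. -/
theorem lintegral_condKernel_swap {α : Type*} [MeasurableSpace α] [StandardBorelSpace X₁]
    [Nonempty X₁] [MeasurableSpace.CountableOrCountablyGenerated α X₂]
    (κ : Kernel α (X₁ × X₂)) [IsFiniteKernel κ] {f : X₁ × X₂ → ENNReal} (hf : Measurable f)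
    (a : α) :
    ∫⁻ x₂, ∫⁻ x₁, f (x₁, x₂) ∂((κ.map Prod.swap).condKernel (a, x₂)) ∂((κ a).map Prod.snd)
      = ∫⁻ p, f p ∂(κ a) := by
  have h := lintegral_condKernel (κ := κ.map Prod.swap) (hf.comp measurable_swap) a
  rw [Kernel.fst_apply, Kernel.map_apply _ measurable_swap,
    Measure.map_map measurable_fst measurable_swap,
    lintegral_map (hf.comp measurable_swap) measurable_swap] at h
  exact h

end Lifting

/-! ### The coupling strategy and its one-step inequality. -/

section Coupling

/-- The memory of the coupling strategy: a flag marking the initial memory, and the last simulated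
control, the last simulated state and the last state of the controlled system. -/
abbrev CouplingMemory {Y : Type v} [MeasurableSpace Y] (M₁ M₂ : GMDP.{u, v} Y) : Type u :=
  ULift.{u} Bool × M₁.A × M₁.X × M₂.X

variable {Y : Type v} [MeasurableSpace Y] {M₁ M₂ : GMDP.{u, v} Y}

/-- The joint law of the next pair of states given the memory. -/
noncomputable def couplingKernel (W : Kernel (M₁.A × M₁.X × M₂.X) (M₁.X × M₂.X))
    (W₀ : Measure (M₁.X × M₂.X)) : Kernel (CouplingMemory M₁ M₂) (M₁.X × M₂.X) where
  toFun c := if c.1.down = true then W₀ else W c.2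
  measurable' := Measurable.ite
    ((measurableSet_singleton true).preimage (measurable_down.comp measurable_fst))
    measurable_const (W.measurable.comp measurable_snd)

theorem couplingKernel_true (W : Kernel (M₁.A × M₁.X × M₂.X) (M₁.X × M₂.X))
    (W₀ : Measure (M₁.X × M₂.X)) (c : M₁.A × M₁.X × M₂.X) :
    couplingKernel W W₀ (⟨true⟩, c) = W₀ := by
  change (if true = true then W₀ else W c) = W₀
  simp

theorem couplingKernel_false (W : Kernel (M₁.A × M₁.X × M₂.X) (M₁.X × M₂.X))
    (W₀ : Measure (M₁.X × M₂.X)) (c : M₁.A × M₁.X × M₂.X) :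
    couplingKernel W W₀ (⟨false⟩, c) = W c := by
  change (if false = true then W₀ else W c) = W c
  simp

instance (W : Kernel (M₁.A × M₁.X × M₂.X) (M₁.X × M₂.X)) (W₀ : Measure (M₁.X × M₂.X))
    [IsMarkovKernel W] [IsProbabilityMeasure W₀] : IsMarkovKernel (couplingKernel W W₀) := by
  refine ⟨?_⟩
  rintro ⟨⟨_ | _⟩, c⟩
  · rw [couplingKernel_false]; infer_instance
  · rw [couplingKernel_true]; infer_instance

/-- The memory update of the coupling strategy: draw the simulated state from `Q`, then the
simulated control from `ν`. -/
noncomputable def couplingUpdate (Q : Kernel (CouplingMemory M₁ M₂ × M₂.X) M₁.X)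
    (ν : Kernel M₁.X M₁.A) : Kernel (CouplingMemory M₁ M₂ × M₂.X) (CouplingMemory M₁ M₂) :=
  (Kernel.id ×ₖ (Q ⊗ₖ ν.comap Prod.snd measurable_snd)).map
    fun p => (⟨false⟩, p.2.2, p.2.1, p.1.2)

theorem measurable_couplingUpdate_aux :
    Measurable fun p : (CouplingMemory M₁ M₂ × M₂.X) × M₁.X × M₁.A =>
      ((⟨false⟩, p.2.2, p.2.1, p.1.2) : CouplingMemory M₁ M₂) := by fun_prop

instance (Q : Kernel (CouplingMemory M₁ M₂ × M₂.X) M₁.X) (ν : Kernel M₁.X M₁.A)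
    [IsMarkovKernel Q] [IsMarkovKernel ν] : IsMarkovKernel (couplingUpdate Q ν) := by
  unfold couplingUpdate
  exact Kernel.IsMarkovKernel.map _ measurable_couplingUpdate_aux

theorem lintegral_couplingUpdate (Q : Kernel (CouplingMemory M₁ M₂ × M₂.X) M₁.X)
    (ν : Kernel M₁.X M₁.A) [IsMarkovKernel Q] [IsMarkovKernel ν]
    {f : CouplingMemory M₁ M₂ → ENNReal} (hf : Measurable f) (s : CouplingMemory M₁ M₂ × M₂.X) :
    ∫⁻ c, f c ∂(couplingUpdate Q ν s) =
      ∫⁻ x, ∫⁻ a, f (⟨false⟩, a, x, s.2) ∂(ν x) ∂(Q s) := by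
  have h : Measurable fun p : (CouplingMemory M₁ M₂ × M₂.X) × M₁.X × M₁.A =>
      f (⟨false⟩, p.2.2, p.2.1, p.1.2) := hf.comp measurable_couplingUpdate_aux
  rw [couplingUpdate, Kernel.map_apply _ measurable_couplingUpdate_aux,
    lintegral_map hf measurable_couplingUpdate_aux, Kernel.prod_apply, Kernel.id_apply,
    Measure.dirac_prod,
    lintegral_map h measurable_prodMk_left,
    Kernel.lintegral_compProd _ _ _ (by exact h.comp measurable_prodMk_left)]
  rfl

variable {K : Set Y} {δ : ℝ}

/-- The iterates of the robust operator of a Borel policy are Borel. -/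
theorem measurable_iterate_robustOp (hK : MeasurableSet K) (ν : Kernel M₁.X M₁.A)
    [IsMarkovKernel ν] (q : ℕ) :
    Measurable ((robustOp M₁ K δ (UMKernel.ofKernel ν))^[q] 0) := by
  induction q with
  | zero => exact measurable_const
  | succ q ih =>
    rw [Function.iterate_succ_apply']
    have h1 : Measurable (reachFun M₁ K ((robustOp M₁ K δ (UMKernel.ofKernel ν))^[q] 0)) :=
      (measurable_const.indicator (M₁.measurable_h hK)).add
        (ih.indicator (M₁.measurable_h hK).compl)
    have h2 := (h1.stronglyMeasurable.integral_kernel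
      (κ := transKernel M₁ id measurable_id ν)).measurable
    simp only [transKernel_apply] at h2
    exact continuous_trunc.measurable.comp (h2.sub_const δ)

/-- The robust value after `j` steps, as an extended nonnegative function that is `1` on the
target. -/
noncomputable def stepValue (M : GMDP.{u, v} Y) (K : Set Y) (δ : ℝ) (ν : UMKernel M.X M.A) (j : ℕ)
    (x : M.X) : ENNReal :=
  ENNReal.ofReal (reachFun M K ((robustOp M K δ ν)^[j] 0) x)

theorem stepValue_le_one (hK : MeasurableSet K) (ν : UMKernel M₁.X M₁.A) (j : ℕ) (x : M₁.X) :
    stepValue M₁ K δ ν j x ≤ 1 := by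
  rw [← ENNReal.ofReal_one]
  exact ENNReal.ofReal_le_ofReal
    (((unitUniversal_iterate_robustOp hK ν j).reachFun hK).mem_Icc x).2

theorem measurable_stepValue (hK : MeasurableSet K) (ν : Kernel M₁.X M₁.A) [IsMarkovKernel ν]
    (j : ℕ) : Measurable (stepValue M₁ K δ (UMKernel.ofKernel ν) j) :=
  ((measurable_const.indicator (M₁.measurable_h hK)).add
    ((measurable_iterate_robustOp hK ν j).indicator (M₁.measurable_h hK).compl)).ennreal_ofReal

theorem ofReal_trunc_sub_le (hδ : 0 ≤ δ) (r : ℝ) :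
    ENNReal.ofReal (trunc (r - δ)) ≤ ENNReal.ofReal r - ENNReal.ofReal δ := by
  rw [← ENNReal.ofReal_sub _ hδ, trunc]
  refine (ENNReal.ofReal_le_ofReal (min_le_right _ _)).trans ?_
  rw [ENNReal.ofReal_max]
  simp

/-- The deficit paid by a lifting cancels the `δ` in the operator. It serves both the transitions
and the initial measure. -/
theorem ofReal_trunc_integral_le (hK : MeasurableSet K) (hδ : 0 ≤ δ) (ν : UMKernel M₁.X M₁.A)
    (j : ℕ) (m : Measure M₁.X) [IsFiniteMeasure m] {r : ENNReal}
    (h : ∫⁻ x, stepValue M₁ K δ ν j x ∂m ≤ r + ENNReal.ofReal δ) :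
    ENNReal.ofReal (trunc ((∫ x, reachFun M₁ K ((robustOp M₁ K δ ν)^[j] 0) x ∂m) - δ)) ≤ r := by
  refine (ofReal_trunc_sub_le hδ _).trans ?_
  rw [((unitUniversal_iterate_robustOp hK ν j).reachFun hK).ofReal_integral]
  exact tsub_le_iff_right.2 h

theorem stepValue_succ_of_notMem (ν : UMKernel M₁.X M₁.A) (j : ℕ) {x : M₁.X} (hx : M₁.h x ∉ K) :
    stepValue M₁ K δ ν (j + 1) x = ENNReal.ofReal
      (trunc ((∫ y, reachFun M₁ K ((robustOp M₁ K δ ν)^[j] 0) y ∂(M₁.trans x (ν.toFun x))) - δ)) := by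
  rw [stepValue, reachFun_of_notMem hx, Function.iterate_succ_apply', robustOp]

/-- The robust value after `j` steps along the simulated state, averaged over the simulated state
given the memory and the state of the controlled system, and counted on the relation only. -/
noncomputable def coupledValue (K : Set Y) (δ : ℝ) (ν : UMKernel M₁.X M₁.A)
    (R : Set (M₁.X × M₂.X)) (Q : Kernel (CouplingMemory M₁ M₂ × M₂.X) M₁.X) (j : ℕ)
    (s : M₂.X × CouplingMemory M₁ M₂) : ENNReal :=
  ∫⁻ x, R.indicator (fun p => stepValue M₁ K δ ν j p.1) (x, s.1) ∂(Q (s.2, s.1))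

theorem measurable_coupledValue (hK : MeasurableSet K) (ν : Kernel M₁.X M₁.A) [IsMarkovKernel ν]
    {R : Set (M₁.X × M₂.X)} (hR : MeasurableSet R)
    (Q : Kernel (CouplingMemory M₁ M₂ × M₂.X) M₁.X) [IsMarkovKernel Q] (j : ℕ) :
    Measurable (coupledValue K δ (UMKernel.ofKernel ν) R Q j) := by
  have h1 : Measurable (R.indicator fun p : M₁.X × M₂.X =>
      stepValue M₁ K δ (UMKernel.ofKernel ν) j p.1) :=
    ((measurable_stepValue hK ν j).comp measurable_fst).indicator hR
  have h2 := Measurable.lintegral_kernel_prod_right' (κ := Q.comap Prod.swap measurable_swap)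
    (f := fun p : (M₂.X × CouplingMemory M₁ M₂) × M₁.X =>
      R.indicator (fun p => stepValue M₁ K δ (UMKernel.ofKernel ν) j p.1) (p.2, p.1.1))
    (h1.comp (by fun_prop))
  exact h2

theorem coupledValue_le (ν : UMKernel M₁.X M₁.A) (hK : MeasurableSet K) {R : Set (M₁.X × M₂.X)}
    (Q : Kernel (CouplingMemory M₁ M₂ × M₂.X) M₁.X) [IsMarkovKernel Q] (j : ℕ)
    (s : M₂.X × CouplingMemory M₁ M₂) : coupledValue K δ ν R Q j s ≤ 1 := by
  refine (lintegral_mono (g := fun _ => 1) fun x => ?_).trans (by simp)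
  exact Set.indicator_le (fun (p : M₁.X × M₂.X) _ => stepValue_le_one hK ν j p.1) _

variable {R : Set (M₁.X × M₂.X)} {U : Kernel (M₁.A × M₁.X × M₂.X) M₂.A}
  {W : Kernel (M₁.A × M₁.X × M₂.X) (M₁.X × M₂.X)} {W₀ : Measure (M₁.X × M₂.X)}

/-- The kernel drawing the simulated state given the memory and the state of the controlled
system. -/
noncomputable def simulatedState (W : Kernel (M₁.A × M₁.X × M₂.X) (M₁.X × M₂.X))
    (W₀ : Measure (M₁.X × M₂.X)) [IsMarkovKernel W] [IsProbabilityMeasure W₀] [Nonempty M₁.X] :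
    Kernel (CouplingMemory M₁ M₂ × M₂.X) M₁.X :=
  ((couplingKernel W W₀).map Prod.swap).condKernel

instance [IsMarkovKernel W] [IsProbabilityMeasure W₀] [Nonempty M₁.X] :
    IsMarkovKernel (simulatedState W W₀) := by
  unfold simulatedState; infer_instance

theorem lintegral_coupledValue (hK : MeasurableSet K) (ν : Kernel M₁.X M₁.A) [IsMarkovKernel ν]
    (hR : MeasurableSet R) [IsMarkovKernel W] [IsProbabilityMeasure W₀] [Nonempty M₁.X] (j : ℕ)
    (c : CouplingMemory M₁ M₂) :
    ∫⁻ x₂, coupledValue K δ (UMKernel.ofKernel ν) R (simulatedState W W₀) j (x₂, c)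
        ∂((couplingKernel W W₀ c).map Prod.snd)
      = ∫⁻ p, R.indicator (fun p => stepValue M₁ K δ (UMKernel.ofKernel ν) j p.1) p
          ∂(couplingKernel W W₀ c) :=
  lintegral_condKernel_swap (couplingKernel W W₀)
    (((measurable_stepValue hK ν j).comp measurable_fst).indicator hR) c

/-- The one-step inequality along related states. -/
theorem stepValue_succ_le (hK : MeasurableSet K) (hδ : 0 ≤ δ) (ν : Kernel M₁.X M₁.A)
    [IsMarkovKernel ν] (hR : MeasurableSet R) [IsMarkovKernel W] [IsMarkovKernel U]
    [IsProbabilityMeasure W₀] [Nonempty M₁.X]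
    (hlift : ∀ x₁ x₂, (x₁, x₂) ∈ R → ∀ a : M₁.A,
      IsLifting R δ (M₁.T (x₁, a)) (M₂.trans x₂ (U (a, x₁, x₂))) (W (a, x₁, x₂)))
    (j : ℕ) {x₁ : M₁.X} {x₂ : M₂.X} (hx : (x₁, x₂) ∈ R) (hx₁ : M₁.h x₁ ∉ K) :
    stepValue M₁ K δ (UMKernel.ofKernel ν) (j + 1) x₁ ≤
      ∫⁻ a, ∫⁻ y, coupledValue K δ (UMKernel.ofKernel ν) R (simulatedState W W₀) j
        (y, (⟨false⟩, a, x₁, x₂)) ∂(M₂.trans x₂ (U (a, x₁, x₂))) ∂(ν x₁) := by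
  have hm := measurable_stepValue (δ := δ) hK ν j
  -- For a fixed simulated control, averaging `coupledValue` over the next state of `M₂` gives back
  -- the integral over `R` under `W`, and the lifting loses at most `δ`.
  have hstep : ∀ a, ∫⁻ y, stepValue M₁ K δ (UMKernel.ofKernel ν) j y ∂(M₁.T (x₁, a)) ≤
      ∫⁻ y, coupledValue K δ (UMKernel.ofKernel ν) R (simulatedState W W₀) j
        (y, (⟨false⟩, a, x₁, x₂)) ∂(M₂.trans x₂ (U (a, x₁, x₂))) + ENNReal.ofReal δ := by
    intro a
    have hl := hlift x₁ x₂ hx a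
    have h1 := lintegral_coupledValue (δ := δ) (W := W) (W₀ := W₀) hK ν hR j
      (⟨false⟩, a, x₁, x₂)
    rw [couplingKernel_false, hl.map_snd] at h1
    rw [h1]
    exact hl.lintegral_le hR hm (stepValue_le_one hK _ j)
  rw [stepValue_succ_of_notMem _ _ hx₁]
  refine ofReal_trunc_integral_le hK hδ _ j _ ?_
  have hν : (UMKernel.ofKernel ν).toFun x₁ = ν x₁ := rfl
  rw [hν, GMDP.trans, Measure.lintegral_bind
    (by fun_prop : Measurable fun a => M₁.T (x₁, a)).aemeasurable hm.aemeasurable]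
  refine (lintegral_mono hstep).trans (le_of_eq ?_)
  rw [lintegral_add_right _ measurable_const]
  simp

/-- Subsolution property required by `lintegral_le_chainLaw_reach`. On the target the bound `1`
suffices; off it, simulated states outside `R` contribute `0`, and those in `R` are off the target
too, so the one-step inequality applies. -/
theorem coupledValue_succ_le (hK : MeasurableSet K) (hδ : 0 ≤ δ) (ν : Kernel M₁.X M₁.A)
    [IsMarkovKernel ν] (hR : MeasurableSet R) [IsMarkovKernel W] [IsMarkovKernel U]
    [IsProbabilityMeasure W₀] [Nonempty M₁.X]
    (hh : ∀ x₁ x₂, (x₁, x₂) ∈ R → M₁.h x₁ = M₂.h x₂)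
    (hlift : ∀ x₁ x₂, (x₁, x₂) ∈ R → ∀ a : M₁.A,
      IsLifting R δ (M₁.T (x₁, a)) (M₂.trans x₂ (U (a, x₁, x₂))) (W (a, x₁, x₂)))
    (j : ℕ) (s : M₂.X × CouplingMemory M₁ M₂) :
    coupledValue K δ (UMKernel.ofKernel ν) R (simulatedState W W₀) (j + 1) s ≤
      {s : M₂.X × CouplingMemory M₁ M₂ | M₂.h s.1 ∈ K}.indicator 1 s +
      {s : M₂.X × CouplingMemory M₁ M₂ | M₂.h s.1 ∈ K}ᶜ.indicator (fun s =>
        ∫⁻ s', coupledValue K δ (UMKernel.ofKernel ν) R (simulatedState W W₀) j s'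
          ∂(stepKernel (couplingUpdate (simulatedState W W₀) ν)
            (U.comap Prod.snd measurable_snd) s)) s := by
  have hm := measurable_coupledValue (δ := δ) hK ν hR (simulatedState W W₀) j
  by_cases hs : M₂.h s.1 ∈ K
  · refine (coupledValue_le _ hK _ _ s).trans (le_add_right ?_)
    rw [Set.indicator_of_mem (by exact hs)]
    rfl
  · refine le_add_left ?_
    rw [Set.indicator_of_mem (by exact hs), lintegral_stepKernel _ _ hm,
      lintegral_couplingUpdate]
    · refine lintegral_mono fun x => ?_
      by_cases hx : (x, s.1) ∈ R
      · rw [Set.indicator_of_mem hx]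
        exact stepValue_succ_le hK hδ ν hR hlift j hx (by rwa [hh _ _ hx])
      · rw [Set.indicator_of_notMem hx]
        exact bot_le
    · have h := Measurable.lintegral_kernel_prod_right'
        (κ := transKernel M₂ (fun _ : CouplingMemory M₁ M₂ => s.1) measurable_const
          (U.comap Prod.snd measurable_snd))
        (f := fun p => coupledValue K δ (UMKernel.ofKernel ν) R (simulatedState W W₀) j p.swap)
        (hm.comp measurable_swap)
      simp only [transKernel_apply, Kernel.comap_apply] at h
      exact h

/-- The coupling strategy for a Borel policy of the simulated system. -/
noncomputable abbrev couplingStrategy (ν : Kernel M₁.X M₁.A) [IsMarkovKernel ν]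
    (U : Kernel (M₁.A × M₁.X × M₂.X) M₂.A) (W : Kernel (M₁.A × M₁.X × M₂.X) (M₁.X × M₂.X))
    (W₀ : Measure (M₁.X × M₂.X)) [IsMarkovKernel U] [IsMarkovKernel W] [IsProbabilityMeasure W₀]
    [Nonempty M₁.X] (c : M₁.A × M₁.X × M₂.X) : ControlStrategy M₂ where
  X := CouplingMemory M₁ M₂
  x0 := (⟨true⟩, c)
  T := UMKernel.ofKernel (couplingUpdate (simulatedState W W₀) ν)
  h := UMKernel.ofKernel (U.comap Prod.snd measurable_snd)

end Coupling

/-! ### Robust reachability and the final statement. -/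

theorem robustlyReaches_ofKernel {Y : Type v} [MetricSpace Y] [MeasurableSpace Y]
    {M₁ : GMDP.{u, v} Y} {K : Set Y} (hK : MeasurableSet K) {δ : ℝ} (ν : Kernel M₁.X M₁.A)
    [IsMarkovKernel ν] (μ : MarkovPolicy M₁) :
    RobustlyReaches M₁ K 0 δ μ (robustProb M₁ K δ (UMKernel.ofKernel ν)) := by
  rintro M₂ ⟨R, U, W, hR, hU, hW, hdist, hlift, W₀, hW₀⟩
  have := hW₀.isProb
  have hδ := hW₀.deficit_nonneg
  have hh : ∀ x₁ x₂, (x₁, x₂) ∈ R → M₁.h x₁ = M₂.h x₂ := fun x₁ x₂ hx =>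
    dist_le_zero.1 (hdist x₁ x₂ hx)
  have hX₁ : Nonempty M₁.X := nonempty_of_isProbabilityMeasure M₁.init
  -- The points `x₁`, `x₂`, `a` only fill the initial memory; while the flag is `true`,
  -- `couplingKernel` ignores them and uses `W₀`.
  obtain ⟨x₁⟩ := id hX₁
  obtain ⟨x₂⟩ := nonempty_of_isProbabilityMeasure M₂.init
  obtain ⟨a⟩ := nonempty_of_isProbabilityMeasure (ν x₁)
  let C := couplingStrategy ν U W W₀ (a, x₁, x₂)
  let κ : Kernel (M₂.X × CouplingMemory M₁ M₂) (M₂.X × CouplingMemory M₁ M₂) :=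
    stepKernel (couplingUpdate (simulatedState W W₀) ν) (U.comap Prod.snd measurable_snd)
  have hκ : IsMarkovKernel κ := by unfold κ; infer_instance
  let ρ : Measure (M₂.X × CouplingMemory M₁ M₂) :=
    M₂.init.prod (Measure.dirac (⟨true⟩, a, x₁, x₂))
  refine ⟨C, chainLaw ρ κ, isExecutionLaw_chainLaw C
    (couplingUpdate (simulatedState W W₀) ν) (U.comap Prod.snd measurable_snd) rfl rfl, ?_⟩
  have hbound : ∀ j, trunc ((∫ x, reachFun M₁ K
      ((robustOp M₁ K δ (UMKernel.ofKernel ν))^[j] 0) x ∂M₁.init) - δ) ≤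
      (chainLaw ρ κ).real (eventuallyReaches C K) := by
    intro j
    have h1 := lintegral_le_chainLaw_reach (ρ := ρ) (κ := κ)
      (H := {s : M₂.X × CouplingMemory M₁ M₂ | M₂.h s.1 ∈ K})
      (hK.preimage (M₂.measurable_h.comp measurable_fst))
      (v := coupledValue K δ (UMKernel.ofKernel ν) R (simulatedState W W₀))
      (measurable_coupledValue hK ν hR _) ?_ (coupledValue_succ_le hK hδ ν hR hh hlift) j
    · have h2 := lintegral_coupledValue (δ := δ) (W := W) (W₀ := W₀) hK ν hR j
        (⟨true⟩, a, x₁, x₂)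
      rw [couplingKernel_true, hW₀.map_snd] at h2
      have h3 := hW₀.lintegral_le hR (measurable_stepValue (δ := δ) hK ν j)
        (stepValue_le_one hK _ j)
      rw [← h2] at h3
      have h4 := ofReal_trunc_integral_le hK hδ _ j _ h3
      have h5 : ∫⁻ s, coupledValue K δ (UMKernel.ofKernel ν) R (simulatedState W W₀) j s ∂ρ =
          ∫⁻ x₂', coupledValue K δ (UMKernel.ofKernel ν) R (simulatedState W W₀) j
            (x₂', (⟨true⟩, a, x₁, x₂)) ∂M₂.init := by
        have hm := measurable_coupledValue (δ := δ) hK ν hR (simulatedState W W₀) j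
        rw [lintegral_prod _ hm.aemeasurable]
        refine lintegral_congr fun y => ?_
        exact lintegral_dirac' _ (hm.comp measurable_prodMk_left)
      rw [h5] at h1
      exact (ENNReal.ofReal_le_iff_le_toReal (measure_ne_top _ _)).1 (h4.trans h1)
    -- Zero steps: off the target the iterate is `0`, and a related simulated state has the same
    -- output.
    · intro s
      by_cases hs : M₂.h s.1 ∈ K
      · rw [Set.indicator_of_mem (by exact hs)]
        exact coupledValue_le _ hK _ _ s
      · rw [Set.indicator_of_notMem (by exact hs), coupledValue]
        refine le_of_eq ((lintegral_congr fun x => ?_).trans lintegral_zero)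
        by_cases hx : (x, s.1) ∈ R
        · rw [Set.indicator_of_mem hx, stepValue, reachFun_of_notMem (by rwa [hh _ _ hx])]
          simp
        · rw [Set.indicator_of_notMem hx]
  have hlim := (continuous_trunc.tendsto _).comp ((tendsto_integral_reachFun hK
    (unitUniversal_iterate_robustOp (δ := δ) hK (UMKernel.ofKernel ν))
    (isIteratedFixedPoint_robustValue hK (UMKernel.ofKernel ν)).tendsto M₁.init).sub_const δ)
  exact le_of_tendsto' hlim hbound

/-- The strategy built from the Borel replacement serves for `μ`, since robust reachability depends
on the policy only through the probability claimed. -/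
theorem robustlyReaches_robustProb {Y : Type v} [MetricSpace Y] [MeasurableSpace Y]
    {M₁ : GMDP.{u, v} Y} {K : Set Y} (hK : MeasurableSet K) (δ : ℝ) (μ : UMKernel M₁.X M₁.A) :
    RobustlyReaches M₁ K 0 δ (homogeneous μ) (robustProb M₁ K δ μ) := by
  obtain ⟨ν, _, h⟩ := exists_kernel_robustProb_eq (δ := δ) hK μ
  rw [h]
  exact robustlyReaches_ofKernel hK ν _

theorem corollary1 {Y : Type v} [MetricSpace Y] [MeasurableSpace Y] [BorelSpace Y]
    (M₁ : GMDP.{u, v} Y) (K : Set Y) (hK : MeasurableSet K) (δ : ℝ) :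
    (∀ μ : UMKernel M₁.X M₁.A,
      IsIteratedFixedPoint (robustOp M₁ K δ μ) (robustValue M₁ K δ μ) ∧
      RobustlyReaches M₁ K 0 δ (homogeneous μ) (robustProb M₁ K δ μ)) ∧
    IsIteratedFixedPoint (robustOpStar M₁ K δ) (robustValueStar M₁ K δ) ∧
    (∀ μs : UMKernel M₁.X M₁.A, IsOptimalRobustPolicy M₁ K δ μs →
      robustOp M₁ K δ μs (robustValueStar M₁ K δ) = robustValueStar M₁ K δ ∧
      RobustlyReaches M₁ K 0 δ (homogeneous μs) (robustProb M₁ K δ μs)) :=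
  ⟨fun μ => ⟨isIteratedFixedPoint_robustValue hK μ, robustlyReaches_robustProb hK δ μ⟩,
    isIteratedFixedPoint_robustValueStar hK,
    fun μs hμs => ⟨hμs.robustOp_eq hK, robustlyReaches_robustProb hK δ μs⟩⟩
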